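/- Let $(K,\partial)$ be a differential field of characteristic zero with field of constants $C$, let $n\ge 1$, and let $L=\partial^n+\upsilon_2\partial^{n-2}+\dots+\upsilon_{n-1}\partial+\upsilon_n\in K[\partial]$ be an operator of order $n$ in normal form. Definitions. Let $L_n=\partial^n+u_2\partial^{n-2}+\dots+u_n$ be the formal operator with coefficients in the ring of differential polynomials $C\{u_2,\dots,u_n\}$, let $Q=L_n^{1/n}$ be its unique monic $n$-th root in $C\{u_2,\dots,u_n\}((\partial^{-1}))$, and for $j\ge 0$ let $P_j=(Q^j)_+$ be the positive part of $Q^j$. Write $[P_j,L_n]=\sum_{k=0}^{n-2}H_{k,j}\,\partial^k$ and let $\sigma_{k,j}\in K$ be the value of $H_{k,j}$ under the differential substitution $u_l\mapsto\upsilon_l$; put $\overline\sigma_j=(\sigma_{0,j},\dots,\sigma_{n-2,j})$. Let $J_{n,m}=\{j\in\{0,\dots,m\}: n\nmid j\}$. Define $$V_m=\Big\{\xi\in C^{J_{n,m}} : \sum_{j\in J_{n,m}}\xi_j\overline\sigma_j=\overline 0\Big\}\quad (m\ge 0),$$ $$F_m=\Big\{\xi\in C^{J_{n,m-1}} : \overline\sigma_m+\sum_{j\in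 J_{n,m-1}}\xi_j\overline\sigma_j=\overline 0\Big\}\quad (m\ge 1,\ n\nmid m),$$ the set of constant solutions of the Gelfand-Dickey system $\mathrm{GD}_{n,m}(L)$. Elements of $C^{J_{n,m}}$ are regarded as elements of $C^{J_{n,m+1}}$ by extension by zero; for $n\nmid m$ and $c\in C^{J_{n,m-1}}$ let $(c,1)\in C^{J_{n,m}}$ be the vector with $m$-th entry $1$ and the other entries those of $c$. Let $\mathcal Z_m(L)$ be the set of operators in $K[\partial]$ of order at most $m$ that commute with $L$. The level of $L$ is the smallest $M\in\mathbb N$ with $\mathcal Z_M(L)\not\subseteq C[L]$, if there is one. Statement. 1. $V_m\subseteq V_{m+1}$ for every $m\ge 0$. In particular, if $L$ has level $M$, there is an infinite flag $V_M\subseteq V_{M+1}\subseteq\cdots$ of $C$-vector spaces. 2. For every $m\ge1$ there is a subspace $T_m$ with $V_m=V_{m-1}\oplus T_m$. Every such $T_m$ has $\dim_C T_m\le 1$, and if $\dim_C T_m=1$, then $n\nmid m$ and $T_m=\langle(\mathbf c_m,1)\rangle$ for some $\mathbf c_m\in C^{J_{n,m-1}}$. 3. Let $m\ge 1$ with $n\nmid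 m$, and let $T_m$ be a subspace with $V_m=V_{m-1}\oplus T_m$. Either $F_m=\emptyset$ and $T_m=0$, or $T_m=\langle(\mathbf c_m,1)\rangle$ for some $\mathbf c_m\in C^{J_{n,m-1}}$ and $F_m=\mathbf c_m+V_{m-1}$, the affine space through $\mathbf c_m$ with direction $V_{m-1}$. In particular, if $L$ has level $M$, then $n\nmid M$ and there is $\mathbf c_M\in C^{J_{n,M-1}}$ with $F_M=\{\mathbf c_M\}$ and $V_M=\langle(\mathbf c_M,1)\rangle$. -/

import Mathlib

open scoped Differential

/-- Pseudo-differential operators `∑_{i ≤ N} a_i ∂^i` with coefficients in `R`: families of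
coefficients indexed by `ℤ` that vanish above some bound. -/
@[ext]
structure PseudoDiffOp (R : Type*) [CommRing R] where
  coeff : ℤ → R
  bdd : ∃ N : ℤ, ∀ i : ℤ, N < i → coeff i = 0

namespace PseudoDiffOp

section Additive

variable {R : Type*} [CommRing R]

theorem coeff_injective : Function.Injective (coeff : PseudoDiffOp R → ℤ → R) :=
  fun _ _ h => PseudoDiffOp.ext h

instance : Zero (PseudoDiffOp R) := ⟨⟨fun _ => 0, 0, fun _ _ => rfl⟩⟩

instance : Add (PseudoDiffOp R) :=
  ⟨fun A B => ⟨fun i => A.coeff i + B.coeff i, by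
    obtain ⟨a, ha⟩ := A.bdd
    obtain ⟨b, hb⟩ := B.bdd
    exact ⟨max a b, fun i hi => by simp [ha i (by omega), hb i (by omega)]⟩⟩⟩

instance : Neg (PseudoDiffOp R) :=
  ⟨fun A => ⟨fun i => -A.coeff i, by
    obtain ⟨a, ha⟩ := A.bdd
    exact ⟨a, fun i hi => by simp [ha i hi]⟩⟩⟩

instance : Sub (PseudoDiffOp R) :=
  ⟨fun A B => ⟨fun i => A.coeff i - B.coeff i, by
    obtain ⟨a, ha⟩ := A.bdd
    obtain ⟨b, hb⟩ := B.bdd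
    exact ⟨max a b, fun i hi => by simp [ha i (by omega), hb i (by omega)]⟩⟩⟩

/-- Multiplication of all coefficients from the left by a scalar. -/
instance {S : Type*} [Monoid S] [DistribMulAction S R] : SMul S (PseudoDiffOp R) :=
  ⟨fun c A => ⟨fun i => c • A.coeff i, by
    obtain ⟨a, ha⟩ := A.bdd
    exact ⟨a, fun i hi => by simp [ha i hi]⟩⟩⟩

@[simp] theorem zero_coeff (i : ℤ) : (0 : PseudoDiffOp R).coeff i = 0 := rfl
@[simp] theorem add_coeff (A B : PseudoDiffOp R) (i : ℤ) :
    (A + B).coeff i = A.coeff i + B.coeff i := rfl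
@[simp] theorem neg_coeff (A : PseudoDiffOp R) (i : ℤ) : (-A).coeff i = -A.coeff i := rfl
@[simp] theorem sub_coeff (A B : PseudoDiffOp R) (i : ℤ) :
    (A - B).coeff i = A.coeff i - B.coeff i := rfl
@[simp] theorem smul_coeff {S : Type*} [Monoid S] [DistribMulAction S R] (c : S)
    (A : PseudoDiffOp R) (i : ℤ) : (c • A).coeff i = c • A.coeff i := rfl

instance : AddCommGroup (PseudoDiffOp R) :=
  coeff_injective.addCommGroup coeff rfl (fun _ _ => rfl) (fun _ => rfl) (fun _ _ => rfl)
    (fun _ _ => rfl) (fun _ _ => rfl)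

/-- The operator `a ∂^d`. -/
def monomial (d : ℤ) (a : R) : PseudoDiffOp R :=
  ⟨fun i => if i = d then a else 0, d, fun i hi => by simp [hi.ne']⟩

@[simp] theorem monomial_coeff (d : ℤ) (a : R) (i : ℤ) :
    (monomial d a).coeff i = if i = d then a else 0 := rfl

instance : One (PseudoDiffOp R) := ⟨monomial 0 1⟩

@[simp] theorem one_coeff (i : ℤ) : (1 : PseudoDiffOp R).coeff i = if i = 0 then 1 else 0 := rfl

end Additive

section Mul

variable {R : Type*} [CommRing R] [Differential R]

/-- The contribution of `a_i ∂^i` and of the `k`-th term of the Leibniz rule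
`∂^i b = ∑_k (i choose k) b^(k) ∂^(i-k)`, with `p = (i, k)`, to the coefficient of `∂^l`
in `A B`. -/
def mulTerm (A B : PseudoDiffOp R) (l : ℤ) (p : ℤ × ℕ) : R :=
  Ring.choose p.1 p.2 •
    (A.coeff p.1 * (⇑(Differential.deriv : Derivation ℤ R R))^[p.2] (B.coeff (l - p.1 + p.2)))

theorem iter_zero (k : ℕ) : (⇑(Differential.deriv : Derivation ℤ R R))^[k] 0 = 0 :=
  iterate_map_zero _ k

theorem mulTerm_ne {A B : PseudoDiffOp R} {a b l : ℤ} (ha : ∀ i, a < i → A.coeff i = 0)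
    (hb : ∀ i, b < i → B.coeff i = 0) {p : ℤ × ℕ} (h : mulTerm A B l p ≠ 0) :
    p.1 ≤ a ∧ l - p.1 + p.2 ≤ b := by
  constructor
  · by_contra h1
    exact h (by simp [mulTerm, ha _ (not_le.mp h1)])
  · by_contra h1
    exact h (by simp [mulTerm, hb _ (not_le.mp h1)])

theorem mulTerm_finite (A B : PseudoDiffOp R) (l : ℤ) :
    (Function.support (mulTerm A B l)).Finite := by
  obtain ⟨a, ha⟩ := A.bdd
  obtain ⟨b, hb⟩ := B.bdd
  refine ((Set.finite_Icc (l - b) a).prod (Set.finite_Iic (a + b - l).toNat)).subset ?_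
  intro p hp
  have := mulTerm_ne ha hb hp
  simp only [Set.mem_prod, Set.mem_Icc, Set.mem_Iic]
  omega

/-- The product of pseudo-differential operators. -/
noncomputable instance : Mul (PseudoDiffOp R) :=
  ⟨fun A B => ⟨fun l => ∑ᶠ p : ℤ × ℕ, mulTerm A B l p, by
    obtain ⟨a, ha⟩ := A.bdd
    obtain ⟨b, hb⟩ := B.bdd
    refine ⟨a + b, fun l hl => finsum_eq_zero_of_forall_eq_zero fun p => ?_⟩
    by_contra h
    have := mulTerm_ne ha hb h
    omega⟩⟩

theorem mul_coeff (A B : PseudoDiffOp R) (l : ℤ) :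
    (A * B).coeff l = ∑ᶠ p : ℤ × ℕ, mulTerm A B l p := rfl

theorem iter_add (k : ℕ) (x y : R) : (⇑(Differential.deriv : Derivation ℤ R R))^[k] (x + y) =
    (⇑(Differential.deriv : Derivation ℤ R R))^[k] x +
    (⇑(Differential.deriv : Derivation ℤ R R))^[k] y :=
  iterate_map_add _ k x y

theorem iter_mul (k : ℕ) (x y : R) : (⇑(Differential.deriv : Derivation ℤ R R))^[k] (x * y) =
    ∑ p ∈ Finset.HasAntidiagonal.antidiagonal k, k.choose p.1 •
    ((⇑(Differential.deriv : Derivation ℤ R R))^[p.1] x *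
    (⇑(Differential.deriv : Derivation ℤ R R))^[p.2] y) := by
  induction k with
  | zero => simp
  | succ k ih =>
    rw [Finset.sum_antidiagonal_choose_succ_nsmul (M := R) (fun i j =>
      (⇑(Differential.deriv : Derivation ℤ R R))^[i] x *
      (⇑(Differential.deriv : Derivation ℤ R R))^[j] y) k, ← Finset.sum_add_distrib,
      Function.iterate_succ_apply', ih, map_sum]
    refine Finset.sum_congr rfl fun p hp => ?_
    rw [← Nat.choose_symm_of_eq_add (Finset.HasAntidiagonal.mem_antidiagonal.mp hp).symm,
      map_nsmul, Derivation.leibniz, Function.iterate_succ_apply', Function.iterate_succ_apply']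
    simp only [smul_eq_mul, nsmul_add]
    rw [mul_comm ((⇑(Differential.deriv : Derivation ℤ R R))^[p.2] y)]

theorem finsum_antidiagonal {ι M : Type*} [AddCommMonoid M] (f : ι × ℕ × ℕ → M)
    (hf : (Function.support f).Finite) :
    ∑ᶠ x : ι × ℕ, ∑ p ∈ Finset.HasAntidiagonal.antidiagonal x.2, f (x.1, p) = ∑ᶠ z, f z := by
  classical
  set g : ι × ℕ × ℕ → ι × ℕ := fun z => (z.1, z.2.1 + z.2.2)
  have key : ∀ x : ι × ℕ, ∑ p ∈ Finset.HasAntidiagonal.antidiagonal x.2, f (x.1, p) =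
      ∑ z ∈ hf.toFinset with g z = x, f z := by
    intro x
    rw [← Finset.sum_image (g := fun p : ℕ × ℕ => (x.1, p)) (f := f)
      (fun _ _ _ _ h => by simpa using h)]
    symm
    apply Finset.sum_subset
    · intro z hz
      simp only [Finset.mem_filter, g] at hz
      obtain ⟨-, rfl⟩ := hz
      exact Finset.mem_image.mpr ⟨z.2, by simp, rfl⟩
    · intro z hz hz'
      by_contra h
      apply hz'
      obtain ⟨p, hp, rfl⟩ := Finset.mem_image.mp hz
      simp only [Finset.HasAntidiagonal.mem_antidiagonal] at hp
      simp [g, hp, h]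
  rw [finsum_eq_sum_of_support_subset (s := hf.toFinset.image g)]
  · rw [finsum_eq_sum_of_support_subset f (s := hf.toFinset) (by simp),
      ← Finset.sum_fiberwise_of_maps_to (g := g) (t := hf.toFinset.image g)
        (fun z hz => Finset.mem_image_of_mem g hz)]
    exact Finset.sum_congr rfl fun x _ => key x
  · intro x hx
    rw [Function.mem_support, key x] at hx
    obtain ⟨z, hz, -⟩ := Finset.exists_ne_zero_of_sum_ne_zero hx
    rw [Finset.mem_filter] at hz
    exact Finset.mem_coe.mpr (Finset.mem_image.mpr ⟨z, hz⟩)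

theorem mul_assoc_aux (A B C : PseudoDiffOp R) : A * B * C = A * (B * C) := by
  obtain ⟨a, ha⟩ := A.bdd
  obtain ⟨b, hb⟩ := B.bdd
  obtain ⟨c, hc⟩ := C.bdd
  ext l
  set D : ℕ → R → R := fun k => (⇑(Differential.deriv : Derivation ℤ R R))^[k] with hD
  have D0 : ∀ k, D k 0 = 0 := iter_zero
  -- the common normal form of both sides, indexed by `((i, j, t), (t', q))`
  set H : (ℤ × ℤ × ℕ) × ℕ × ℕ → R := fun z =>
    (Ring.choose z.1.1 z.1.2.2 * (Ring.choose (z.1.1 - z.1.2.2) z.2.1 *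
      Ring.choose z.1.2.1 z.2.2)) •
      (A.coeff z.1.1 * (D z.1.2.2 (B.coeff z.1.2.1) *
        D (z.2.1 + z.2.2) (C.coeff (l - z.1.1 - z.1.2.1 + z.1.2.2 + (z.2.1 + z.2.2 : ℕ))))) with hH
  have bound : ∀ (i j : ℤ) (u v : R → R), u 0 = 0 → v 0 = 0 → ∀ (k : ℤ) (w : ℤ),
      w • (A.coeff i * (u (B.coeff j) * v (C.coeff k))) ≠ 0 → i ≤ a ∧ j ≤ b ∧ k ≤ c := by
    intro i j u v hu hv k w h
    refine ⟨?_, ?_, ?_⟩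
    · by_contra h1
      exact h (by simp [ha _ (not_le.mp h1)])
    · by_contra h1
      exact h (by simp [hb _ (not_le.mp h1), hu])
    · by_contra h1
      exact h (by simp [hc _ (not_le.mp h1), hv])
  have hHfin : (Function.support H).Finite := by
    refine (((Set.finite_Icc (l - b - c) a).prod ((Set.finite_Icc (l - a - c) b).prod
      (Set.finite_Iic (a + b + c - l).toNat))).prod ((Set.finite_Iic (a + b + c - l).toNat).prod
      (Set.finite_Iic (a + b + c - l).toNat))).subset ?_
    intro z hz
    have := bound _ _ _ _ (D0 _) (D0 _) _ _ hz
    simp only [Set.mem_prod, Set.mem_Icc, Set.mem_Iic]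
    omega
  trans ∑ᶠ z, H z
  · set F : (ℤ × ℕ) × (ℤ × ℕ) → R := fun z =>
      (Ring.choose z.2.1 z.2.2 * Ring.choose z.1.1 z.1.2) •
      (A.coeff z.2.1 * (D z.2.2 (B.coeff (z.1.1 - z.2.1 + z.2.2)) *
        D z.1.2 (C.coeff (l - z.1.1 + z.1.2)))) with hF
    have hFfin : (Function.support F).Finite := by
      refine (((Set.finite_Icc (l - c) (a + b)).prod
        (Set.finite_Iic (a + b + c - l).toNat)).prod ((Set.finite_Icc (l - b - c) a).prod
        (Set.finite_Iic (a + b + c - l).toNat))).subset ?_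
      intro z hz
      have := bound _ _ _ _ (D0 _) (D0 _) _ _ hz
      simp only [Set.mem_prod, Set.mem_Icc, Set.mem_Iic]
      omega
    have h1 : (A * B * C).coeff l = ∑ᶠ z, F z := by
      rw [finsum_curry F hFfin, mul_coeff]
      refine finsum_congr fun x => ?_
      rw [mulTerm, mul_coeff]
      have := AddMonoidHom.map_finsum ((DistribSMul.toAddMonoidHom R (Ring.choose x.1 x.2)).comp
        (AddMonoidHom.mulRight (D x.2 (C.coeff (l - x.1 + x.2))))) (mulTerm_finite A B x.1)
      refine this.trans (finsum_congr fun y => ?_)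
      simp only [AddMonoidHom.comp_apply, AddMonoidHom.coe_mulRight,
        DistribSMul.toAddMonoidHom_apply, mulTerm, hF, hD, zsmul_eq_mul]
      push_cast
      ring
    let e : (ℤ × ℕ) × (ℤ × ℕ) ≃ (ℤ × ℤ × ℕ) × ℕ :=
      { toFun := fun z => ((z.2.1, z.1.1 - z.2.1 + z.2.2, z.2.2), z.1.2)
        invFun := fun z => ((z.1.2.1 + z.1.1 - z.1.2.2, z.2), (z.1.1, z.1.2.2))
        left_inv := fun z => by ext <;> (dsimp only; try ring)
        right_inv := fun z => by ext <;> (dsimp only; try ring) }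
    rw [h1, ← finsum_antidiagonal H hHfin, ← finsum_comp_equiv e]
    refine finsum_congr fun z => ?_
    obtain ⟨⟨r, s⟩, ⟨i, t⟩⟩ := z
    simp only [hF, hH, e, Equiv.coe_fn_mk]
    have hv := Ring.add_choose_eq (r := i - (t : ℤ)) (s := r - i + t) s (Commute.all _ _)
    rw [show i - (t : ℤ) + (r - i + t) = r by ring] at hv
    rw [hv, Finset.mul_sum, Finset.sum_smul]
    refine Finset.sum_congr rfl fun p hp => ?_
    rw [Finset.HasAntidiagonal.mem_antidiagonal.mp hp, show l - i - (r - i + t) + t + (s : ℤ) = l - r + s by ring]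
  · set F : (ℤ × ℕ) × (ℤ × ℕ) → R := fun z =>
      Ring.choose z.1.1 z.1.2 • (A.coeff z.1.1 * (D z.1.2 (Ring.choose z.2.1 z.2.2 •
      (B.coeff z.2.1 * D z.2.2 (C.coeff (l - z.1.1 + z.1.2 - z.2.1 + z.2.2)))))) with hF
    have hFfin : (Function.support F).Finite := by
      refine (((Set.finite_Icc (l - b - c) a).prod
        (Set.finite_Iic (a + b + c - l).toNat)).prod ((Set.finite_Icc (l - a - c) b).prod
        (Set.finite_Iic (a + b + c - l).toNat))).subset ?_
      intro z hz
      have : z.1.1 ≤ a ∧ z.2.1 ≤ b ∧ l - z.1.1 + z.1.2 - z.2.1 + z.2.2 ≤ c := by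
        refine ⟨?_, ?_, ?_⟩
        · by_contra h1
          exact hz (by simp [hF, ha _ (not_le.mp h1)])
        · by_contra h1
          exact hz (by simp [hF, hb _ (not_le.mp h1), D0])
        · by_contra h1
          exact hz (by simp [hF, hc _ (not_le.mp h1), D0])
      simp only [Set.mem_prod, Set.mem_Icc, Set.mem_Iic]
      omega
    have h1 : (A * (B * C)).coeff l = ∑ᶠ z, F z := by
      rw [finsum_curry F hFfin, mul_coeff]
      refine finsum_congr fun x => ?_
      rw [mulTerm, mul_coeff]
      have := AddMonoidHom.map_finsum ((DistribSMul.toAddMonoidHom R (Ring.choose x.1 x.2)).comp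
        ((AddMonoidHom.mulLeft (A.coeff x.1)).comp
          (AddMonoidHom.mk' (D x.2) (iter_add x.2)))) (mulTerm_finite B C (l - x.1 + x.2))
      exact this
    let e : (ℤ × ℕ) × (ℤ × ℕ) ≃ (ℤ × ℤ × ℕ) × ℕ :=
      { toFun := fun z => ((z.1.1, z.2.1, z.2.2), z.1.2)
        invFun := fun z => ((z.1.1, z.2), (z.1.2.1, z.1.2.2))
        left_inv := fun z => rfl
        right_inv := fun z => rfl }
    let e' : (ℤ × ℤ × ℕ) × ℕ × ℕ ≃ (ℤ × ℤ × ℕ) × ℕ × ℕ :=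
      { toFun := fun z => ((z.1.1, z.1.2.1, z.2.1), (z.2.2, z.1.2.2))
        invFun := fun z => ((z.1.1, z.1.2.1, z.2.2), (z.1.2.2, z.2.1))
        left_inv := fun z => rfl
        right_inv := fun z => rfl }
    have hfin' : (Function.support (fun z => H (e' z))).Finite :=
      hHfin.preimage e'.injective.injOn
    rw [h1, ← finsum_comp_equiv e', ← finsum_antidiagonal _ hfin', ← finsum_comp_equiv e]
    refine finsum_congr fun z => ?_
    obtain ⟨⟨i, p⟩, ⟨j, q⟩⟩ := z
    simp only [hF, hH, e, e', Equiv.coe_fn_mk]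
    have hz : ∀ (k : ℕ) (w : ℤ) (x : R), D k (w • x) = w • D k x := fun k w x =>
      (AddMonoidHom.mk' (D k) (iter_add k)).map_zsmul w x
    rw [hz, show D p (B.coeff j * D q (C.coeff (l - i + p - j + q))) = _ from iter_mul p _ _,
      Finset.smul_sum, Finset.mul_sum, Finset.smul_sum]
    refine Finset.sum_congr rfl fun x hx => ?_
    obtain ⟨t, t'⟩ := x
    obtain rfl : t + t' = p := Finset.HasAntidiagonal.mem_antidiagonal.mp hx
    have hch := Ring.choose_smul_choose i (Nat.le_add_right t t')
    rw [Nat.add_sub_cancel_left] at hch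
    have hch' : Ring.choose i t * (Ring.choose (i - t) t' * Ring.choose j q) =
      Ring.choose i (t + t') * Ring.choose j q * ((t + t').choose t : ℤ) := by
      rw [← mul_assoc, ← hch]
      simp only [nsmul_eq_mul]
      ring
    rw [hch', show l - i - j + (t : ℤ) + ((t' + q : ℕ) : ℤ) = l - i + ((t + t' : ℕ) : ℤ) - j + q by
      push_cast; ring]
    simp only [hD, Function.iterate_add_apply, zsmul_eq_mul, nsmul_eq_mul]
    push_cast
    ring

theorem mul_add_aux (A B C : PseudoDiffOp R) : A * (B + C) = A * B + A * C := by
  ext l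
  rw [add_coeff, mul_coeff, mul_coeff, mul_coeff,
    ← finsum_add_distrib (mulTerm_finite A B l) (mulTerm_finite A C l)]
  refine finsum_congr fun p => ?_
  simp only [mulTerm, add_coeff, iter_add, mul_add, smul_add]

theorem add_mul_aux (A B C : PseudoDiffOp R) : (A + B) * C = A * C + B * C := by
  ext l
  rw [add_coeff, mul_coeff, mul_coeff, mul_coeff,
    ← finsum_add_distrib (mulTerm_finite A C l) (mulTerm_finite B C l)]
  refine finsum_congr fun p => ?_
  simp only [mulTerm, add_coeff, add_mul, smul_add]

theorem iter_const {c : R} (hc : c′ = 0) {k : ℕ} (hk : k ≠ 0) :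
    (⇑(Differential.deriv : Derivation ℤ R R))^[k] c = 0 := by
  obtain ⟨k, rfl⟩ := Nat.exists_eq_succ_of_ne_zero hk
  rw [Function.iterate_succ_apply, hc, iter_zero]

theorem one_mul_aux (A : PseudoDiffOp R) : 1 * A = A := by
  ext l
  rw [mul_coeff, finsum_eq_single _ ((0 : ℤ), 0)]
  · simp [mulTerm]
  · rintro ⟨i, k⟩ h
    by_cases hi : i = 0
    · subst hi
      have : 0 < k := Nat.pos_of_ne_zero fun hk => h (by rw [hk])
      simp [mulTerm, Ring.choose_zero_pos ℤ this]
    · simp [mulTerm, hi]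

theorem mul_one_aux (A : PseudoDiffOp R) : A * 1 = A := by
  ext l
  rw [mul_coeff, finsum_eq_single _ (l, 0)]
  · simp [mulTerm]
  · rintro ⟨i, k⟩ h
    by_cases hk : k = 0
    · subst hk
      have : l - i ≠ 0 := fun hi => h (by rw [show i = l by omega])
      simp [mulTerm, this]
    · have : (⇑(Differential.deriv : Derivation ℤ R R))^[k]
          ((1 : PseudoDiffOp R).coeff (l - i + k)) = 0 := by
        rw [one_coeff]
        split_ifs
        · exact iter_const (by simp) hk
        · exact iter_zero k
      rw [mulTerm, this, mul_zero, smul_zero]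

noncomputable instance : Ring (PseudoDiffOp R) :=
  { (inferInstance : AddCommGroup (PseudoDiffOp R)) with
    mul := (· * ·)
    one := 1
    mul_assoc := mul_assoc_aux
    one_mul := one_mul_aux
    mul_one := mul_one_aux
    left_distrib := mul_add_aux
    right_distrib := add_mul_aux
    zero_mul := fun A => by
      ext l
      exact finsum_eq_zero_of_forall_eq_zero fun p => by simp [mulTerm]
    mul_zero := fun A => by
      ext l
      exact finsum_eq_zero_of_forall_eq_zero fun p => by simp [mulTerm] }

/-- `A` has order at most `d`. -/
def OrdLE (A : PseudoDiffOp R) (d : ℤ) : Prop := ∀ i : ℤ, d < i → A.coeff i = 0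

/-- `A` is monic of order `d`. -/
def IsMonicOfOrder (A : PseudoDiffOp R) (d : ℤ) : Prop := A.OrdLE d ∧ A.coeff d = 1

/-- `A` is a differential operator, that is, an element of `R[∂]`. -/
def IsDiffOp (A : PseudoDiffOp R) : Prop := ∀ i : ℤ, i < 0 → A.coeff i = 0

/-- The positive part `A₊ = ∑_{i ≥ 0} a_i ∂^i`. -/
def posPart (A : PseudoDiffOp R) : PseudoDiffOp R :=
  ⟨fun i => if 0 ≤ i then A.coeff i else 0, by
    obtain ⟨a, ha⟩ := A.bdd
    exact ⟨a, fun i hi => by simp [ha i hi]⟩⟩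

/-- `L` is a differential operator of the form `∂^n + a_{n-2} ∂^(n-2) + ⋯ + a_0`. -/
def IsNormalForm (n : ℕ) (L : PseudoDiffOp R) : Prop :=
  L.IsDiffOp ∧ L.IsMonicOfOrder n ∧ L.coeff (n - 1) = 0

theorem OrdLE.mul {A B : PseudoDiffOp R} {a b : ℤ} (hA : A.OrdLE a) (hB : B.OrdLE b) :
    (A * B).OrdLE (a + b) := by
  intro l hl
  refine finsum_eq_zero_of_forall_eq_zero fun p => ?_
  by_contra h
  have := mulTerm_ne hA hB h
  omega

theorem mul_coeff_top {A B : PseudoDiffOp R} {a b : ℤ} (hA : A.OrdLE a) (hB : B.OrdLE b) :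
    (A * B).coeff (a + b) = A.coeff a * B.coeff b := by
  rw [mul_coeff, finsum_eq_single _ (a, 0)]
  · simp [mulTerm]
  · rintro ⟨i, k⟩ h
    by_contra h'
    have := mulTerm_ne hA hB h'
    simp only at this
    exact h (by ext <;> simp <;> omega)

theorem IsMonicOfOrder.pow {Q : PseudoDiffOp R} (hQ : Q.IsMonicOfOrder 1) (m : ℕ) :
    (Q ^ m).IsMonicOfOrder m := by
  induction m with
  | zero =>
    refine ⟨fun i hi => ?_, by simp⟩
    have : i ≠ 0 := by simp at hi; omega
    simp [this]
  | succ m ih =>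
    rw [pow_succ]
    push_cast
    exact ⟨ih.1.mul hQ.1, by rw [mul_coeff_top ih.1 hQ.1, ih.2, hQ.2, one_mul]⟩

/-- Changing `Q` by a term `c ∂^d + ⋯` changes `Q^m` by `m c ∂^(m-1+d) + ⋯`. -/
theorem pow_perturb {Q E : PseudoDiffOp R} {d : ℤ} (hd : d ≤ 0) (hQ : Q.IsMonicOfOrder 1)
    (hE : E.OrdLE d) (m : ℕ) : ((Q + E) ^ m - Q ^ m).OrdLE (m - 1 + d) ∧
      ((Q + E) ^ m - Q ^ m).coeff (m - 1 + d) = m * E.coeff d := by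
  have hQE : (Q + E).IsMonicOfOrder 1 := by
    refine ⟨fun i hi => ?_, ?_⟩
    · rw [add_coeff, hQ.1 i hi, hE i (by omega), add_zero]
    · rw [add_coeff, hQ.2, hE 1 (by omega), add_zero]
  induction m with
  | zero => exact ⟨fun i _ => by simp, by simp⟩
  | succ m ih =>
    have h1 : (Q + E) ^ (m + 1) - Q ^ (m + 1) =
        ((Q + E) ^ m - Q ^ m) * (Q + E) + Q ^ m * E := by
      simp only [pow_succ]
      noncomm_ring
    have e1 : ((m + 1 : ℕ) : ℤ) - 1 + d = (m - 1 + d) + 1 := by push_cast; ring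
    have e2 : ((m + 1 : ℕ) : ℤ) - 1 + d = m + d := by push_cast; ring
    have t1 := ih.1.mul hQE.1
    have t2 := (hQ.pow m).1.mul hE
    have c1 := mul_coeff_top ih.1 hQE.1
    have c2 := mul_coeff_top (hQ.pow m).1 hE
    rw [← e1] at t1 c1
    rw [← e2] at t2 c2
    rw [h1]
    refine ⟨fun i hi => by rw [add_coeff, t1 i hi, t2 i hi, add_zero], ?_⟩
    rw [add_coeff, c1, c2, ih.2, hQE.2, (hQ.pow m).2]
    push_cast
    ring

/-- A monic operator of order `n ≥ 1` has exactly one monic `n`-th root of order `1`. -/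
theorem existsUnique_root [Algebra ℚ R] {n : ℕ} (hn : 0 < n) {L : PseudoDiffOp R}
    (hL : L.IsMonicOfOrder n) : ∃! Q : PseudoDiffOp R, Q.IsMonicOfOrder 1 ∧ Q ^ n = L := by
  have hq : algebraMap ℚ R (n : ℚ)⁻¹ * (n : R) = 1 := by
    rw [← map_natCast (algebraMap ℚ R) n, ← map_mul,
      inv_mul_cancel₀ (Nat.cast_ne_zero.mpr hn.ne'), map_one]
  -- successive approximations
  let step : ℕ → PseudoDiffOp R → PseudoDiffOp R := fun k Q =>
    Q + monomial (-k) (algebraMap ℚ R (n : ℚ)⁻¹ * (L - Q ^ n).coeff (n - 1 - k))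
  let q : ℕ → PseudoDiffOp R := fun k => Nat.rec (monomial 1 1) step k
  have hq_succ : ∀ k, q (k + 1) = step k (q k) := fun _ => rfl
  have hmono : ∀ (d : ℤ) (c : R), (monomial d c).OrdLE d := fun d c i hi => by simp [hi.ne']
  have hqm : ∀ k, (q k).IsMonicOfOrder 1 := by
    intro k
    induction k with
    | zero => exact ⟨hmono 1 1, by simp [q]⟩
    | succ k ih =>
      rw [hq_succ]
      refine ⟨fun i hi => ?_, ?_⟩
      · rw [add_coeff, ih.1 i hi, hmono _ _ i (by omega), add_zero]
      · rw [add_coeff, ih.2, hmono _ _ 1 (by omega), add_zero]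
  have happ : ∀ k : ℕ, (L - (q k) ^ n).OrdLE (n - 1 - k) := by
    intro k
    induction k with
    | zero =>
      intro i hi
      have := (hqm 0).pow n
      rcases eq_or_lt_of_le (show (n : ℤ) ≤ i by simp at hi; omega) with rfl | h
      · rw [sub_coeff, hL.2, this.2, sub_self]
      · rw [sub_coeff, hL.1 i h, this.1 i h, sub_self]
    | succ k ih =>
      have hp := pow_perturb (d := -k) (by omega) (hqm k) (hmono (-k)
        (algebraMap ℚ R (n : ℚ)⁻¹ * (L - (q k) ^ n).coeff (n - 1 - k))) n
      have hs : L - (q (k + 1)) ^ n = (L - (q k) ^ n) - ((q (k + 1)) ^ n - (q k) ^ n) := by abel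
      intro i hi
      rw [hs, sub_coeff]
      rcases eq_or_lt_of_le (show (n : ℤ) - 1 - k ≤ i by push_cast at hi; omega) with rfl | h
      · have h2 := hp.2
        rw [← sub_eq_add_neg] at h2
        refine sub_eq_zero.mpr (Eq.symm (h2.trans ?_))
        rw [monomial_coeff, if_pos rfl, ← mul_assoc, mul_comm (n : R), hq, one_mul]
      · rw [ih i h, show ((q (k + 1)) ^ n - (q k) ^ n).coeff i = 0 from hp.1 i (by omega), sub_self]
  have hstab : ∀ (k j : ℕ) (i : ℤ), -(k : ℤ) < i → (q (k + j)).coeff i = (q k).coeff i := by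
    intro k j i hi
    induction j with
    | zero => rfl
    | succ j ih =>
      rw [← add_assoc, hq_succ, add_coeff, ih, hmono _ _ i (by push_cast; omega), add_zero]
  let Q : PseudoDiffOp R := ⟨fun i => (q (1 - i).toNat).coeff i, 1, fun i hi => (hqm _).1 i hi⟩
  have hQk : ∀ k : ℕ, (Q - q k).OrdLE (-k) := by
    intro k i hi
    have h1 := hstab (1 - i).toNat k i (by omega)
    have h2 := hstab k (1 - i).toNat i hi
    rw [sub_coeff, show Q.coeff i = (q (1 - i).toNat).coeff i from rfl, ← h1, ← h2, add_comm,
      sub_self]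
  have hQ1 : Q.IsMonicOfOrder 1 := ⟨fun i hi => (hqm _).1 i hi, by
    have h := (hqm ((1 : ℤ) - 1).toNat).2
    exact h⟩
  refine ⟨Q, ⟨hQ1, ?_⟩, ?_⟩
  · ext i
    set k := (n - i).toNat
    have h1 := (pow_perturb (d := -k) (by omega) (hqm k) (hQk k) n).1 i (by omega)
    have h2 := happ k i (by omega)
    rw [add_sub_cancel, sub_coeff] at h1
    rw [sub_coeff] at h2
    rw [sub_eq_zero.mp h1, sub_eq_zero.mp h2]
  · rintro Q' ⟨hQ', hpow⟩
    have hQn : Q ^ n = L := by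
      ext i
      set k := (n - i).toNat
      have h1 := (pow_perturb (d := -k) (by omega) (hqm k) (hQk k) n).1 i (by omega)
      have h2 := happ k i (by omega)
      rw [add_sub_cancel, sub_coeff] at h1
      rw [sub_coeff] at h2
      rw [sub_eq_zero.mp h1, sub_eq_zero.mp h2]
    have hdiff : ∀ k : ℕ, (Q' - Q).OrdLE (-k) := by
      intro k
      induction k with
      | zero =>
        intro i hi
        rcases eq_or_lt_of_le (show (1 : ℤ) ≤ i by simp at hi; omega) with rfl | h
        · rw [sub_coeff, hQ'.2, hQ1.2, sub_self]
        · rw [sub_coeff, hQ'.1 i h, hQ1.1 i h, sub_self]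
      | succ k ih =>
        intro i hi
        rcases eq_or_lt_of_le (show -(k : ℤ) ≤ i by push_cast at hi; omega) with rfl | h
        · have h2 := (pow_perturb (d := -k) (by omega) hQ1 ih n).2
          rw [add_sub_cancel, hpow, hQn, sub_self, zero_coeff] at h2
          calc (Q' - Q).coeff (-k) =
              algebraMap ℚ R (n : ℚ)⁻¹ * (n : R) * (Q' - Q).coeff (-k) := by rw [hq, one_mul]
            _ = 0 := by rw [mul_assoc, ← h2, mul_zero]
        · exact ih i h
    ext i
    have := hdiff (1 - i).toNat i (by omega)
    rw [sub_coeff] at this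
    exact sub_eq_zero.mp this

/-- The unique monic `n`-th root `L^{1/n}` of a monic operator `L` of order `n ≥ 1`. -/
noncomputable def nthRoot (n : ℕ) (L : PseudoDiffOp R) : PseudoDiffOp R :=
  Classical.epsilon fun Q : PseudoDiffOp R => Q.IsMonicOfOrder 1 ∧ Q ^ n = L

theorem nthRoot_spec [Algebra ℚ R] {n : ℕ} (hn : 0 < n) {L : PseudoDiffOp R}
    (hL : L.IsMonicOfOrder n) : (nthRoot n L).IsMonicOfOrder 1 ∧ nthRoot n L ^ n = L :=
  Classical.epsilon_spec (existsUnique_root hn hL).exists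

end Mul

end PseudoDiffOp

namespace GelfandDickey

open PseudoDiffOp

section Formal

/-- The indices `2, …, n` of the differential variables `u_2, …, u_n`. -/
abbrev DiffVar (n : ℕ) : Type := {l : ℕ // l ∈ Finset.Icc 2 n}

/-- The ring `C{u_2, …, u_n}` of differential polynomials; `X (l, k)` is `u_l^(k)`. -/
abbrev DiffPoly (n : ℕ) (C : Type*) [Field C] : Type _ := MvPolynomial (DiffVar n × ℕ) C

/-- The `C`-linear derivation of `C{u_2, …, u_n}` with `u_l^(k) ↦ u_l^(k+1)`. -/
noncomputable instance (n : ℕ) (C : Type*) [Field C] : Differential (DiffPoly n C) :=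
  ⟨(MvPolynomial.mkDerivation C
    fun p : DiffVar n × ℕ => (MvPolynomial.X (p.1, p.2 + 1) : DiffPoly n C)).restrictScalars ℤ⟩

variable (n : ℕ) (C : Type*) [Field C]

/-- The formal operator `L_n = ∂^n + u_2 ∂^(n-2) + ⋯ + u_n`. -/
noncomputable def formalOp : PseudoDiffOp (DiffPoly n C) :=
  monomial n 1 + ∑ l : DiffVar n, monomial ((n : ℤ) - (l : ℕ)) (MvPolynomial.X (l, 0))

/-- The homogeneous almost commuting operator `P_j = ((L_n^{1/n})^j)₊`. -/
noncomputable def almostCommutingOp (j : ℕ) : PseudoDiffOp (DiffPoly n C) :=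
  (nthRoot n (formalOp n C) ^ j).posPart

/-- The differential polynomial `H_{k,j}`, the coefficient of `∂^k` in `[P_j, L_n]`. -/
noncomputable def hPoly (k j : ℕ) : DiffPoly n C :=
  ⁅almostCommutingOp n C j, formalOp n C⁆.coeff k

end Formal

section Specialization

variable (K : Type*) [Field K] [Differential K]

/-- The field of constants of a differential field. -/
def constants : Subfield K where
  carrier := {a | a′ = 0}
  mul_mem' {a b} ha hb := by
    simp only [Set.mem_ofPred_eq] at *
    simp [Derivation.leibniz, ha, hb]
  one_mem' := by simp
  add_mem' {a b} ha hb := by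
    simp only [Set.mem_ofPred_eq] at *
    simp [ha, hb]
  zero_mem' := by simp
  neg_mem' {a} ha := by
    simp only [Set.mem_ofPred_eq] at *
    simp [ha]
  inv_mem' a ha := by
    simp only [Set.mem_ofPred_eq] at *
    simp [Derivation.leibniz_inv, ha]

variable {K}

noncomputable instance : Module (constants K) (PseudoDiffOp K) :=
  coeff_injective.module (constants K)
    { toFun := coeff, map_zero' := rfl, map_add' := fun _ _ => rfl } fun _ _ => rfl

theorem iter_smul (c : constants K) (k : ℕ) (x : K) :
    (⇑(Differential.deriv : Derivation ℤ K K))^[k] (c • x) =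
      c • (⇑(Differential.deriv : Derivation ℤ K K))^[k] x := by
  induction k with
  | zero => rfl
  | succ k ih =>
    have hc : (c : K)′ = 0 := c.2
    rw [Function.iterate_succ_apply', Function.iterate_succ_apply', ih, Subfield.smul_def,
      Subfield.smul_def, smul_eq_mul, smul_eq_mul, Derivation.leibniz, hc, smul_zero, add_zero,
      smul_eq_mul]

noncomputable instance : Algebra (constants K) (PseudoDiffOp K) :=
  Algebra.ofModule
    (fun c A B => by
      ext l
      rw [smul_coeff, mul_coeff, mul_coeff]
      refine Eq.symm <| (AddMonoidHom.map_finsum (DistribSMul.toAddMonoidHom K c)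
        (mulTerm_finite A B l)).trans (finsum_congr fun p => ?_)
      simp only [DistribSMul.toAddMonoidHom_apply, mulTerm, smul_coeff]
      rw [smul_mul_assoc, smul_comm])
    (fun c A B => by
      ext l
      rw [smul_coeff, mul_coeff, mul_coeff]
      refine Eq.symm <| (AddMonoidHom.map_finsum (DistribSMul.toAddMonoidHom K c)
        (mulTerm_finite A B l)).trans (finsum_congr fun p => ?_)
      simp only [DistribSMul.toAddMonoidHom_apply, mulTerm, smul_coeff]
      rw [iter_smul, mul_smul_comm, smul_comm])

variable (n : ℕ) (L : PseudoDiffOp K)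

/-- The specialization `u_l^(k) ↦ υ_l^(k)`, where `υ_l` is the coefficient of `∂^(n-l)`
in `L`. -/
noncomputable def specialize : DiffPoly n (constants K) →ₐ[constants K] K :=
  MvPolynomial.aeval fun p : DiffVar n × ℕ =>
    (⇑(Differential.deriv : Derivation ℤ K K))^[p.2] (L.coeff ((n : ℤ) - (p.1 : ℕ)))

/-- The coefficients `σ_{k,j}` of the Gelfand-Dickey systems of `L`. -/
noncomputable def sigma (k j : ℕ) : K := specialize n L (hPoly n (constants K) k j)

/-- The index set `J_{n,m}` of all `j ∈ {0, …, m}` not divisible by `n`. -/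
def indexSet (m : ℕ) : Finset ℕ := (Finset.range (m + 1)).filter fun j => ¬ n ∣ j

/-- `F_m`: the constant solutions of `GD_{n,m}(L)`, the system of the equations
`σ_{k,m} + ∑_{j ∈ J_{n,m-1}} c_j σ_{k,j} = 0` for `k = 0, …, n - 2`. -/
def solGD (m : ℕ) : Set (indexSet n (m - 1) → constants K) :=
  {ξ | ∀ k : ℕ, k + 2 ≤ n →
    sigma n L k m + ∑ j : indexSet n (m - 1), (ξ j : K) * sigma n L k j = 0}

/-- `V_m`: the constant solutions of the homogeneous system `hGD_{n,m}(L)`, the system of the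
equations `∑_{j ∈ J_{n,m}} c_j σ_{k,j} = 0` for `k = 0, …, n - 2`. -/
def solHGD (m : ℕ) : Submodule (constants K) (indexSet n m → constants K) where
  carrier := {ξ | ∀ k : ℕ, k + 2 ≤ n → ∑ j : indexSet n m, (ξ j : K) * sigma n L k j = 0}
  add_mem' {a b} ha hb k hk := by
    have := congrArg₂ (· + ·) (ha k hk) (hb k hk)
    simpa [add_mul, Finset.sum_add_distrib] using this
  zero_mem' k _ := by simp
  smul_mem' c a ha k hk := by
    have := congrArg ((c : K) * ·) (ha k hk)
    simpa [mul_assoc, Finset.mul_sum] using this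

variable (K) in
/-- The natural map `C^{J_{n,k}} → C^{J_{n,m}}`, `ξ ↦ (ξ, 0)`, for `k ≤ m`. -/
def extendZero (k m : ℕ) :
    (indexSet n k → constants K) →ₗ[constants K] (indexSet n m → constants K) where
  toFun ξ j := if h : (j : ℕ) ∈ indexSet n k then ξ ⟨j, h⟩ else 0
  map_add' a b := by
    ext j
    by_cases h : (j : ℕ) ∈ indexSet n k <;> simp [h]
  map_smul' c a := by
    ext j
    by_cases h : (j : ℕ) ∈ indexSet n k <;> simp [h]

/-- The vector `(c, 1)` of `C^{J_{n,m}}` for `c` in `C^{J_{n,m-1}}`, where `m` is not divisible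
by `n`. -/
def appendOne {n m : ℕ} (c : indexSet n (m - 1) → constants K) :
    indexSet n m → constants K :=
  fun j => if h : (j : ℕ) ∈ indexSet n (m - 1) then c ⟨j, h⟩ else 1

/-- `V_m = V_{m-1} ⊕ T`, with `V_{m-1}` embedded in `C^{J_{n,m}}`. -/
def IsStep (m : ℕ) (T : Submodule (constants K) (indexSet n m → constants K)) : Prop :=
  Disjoint ((solHGD n L (m - 1)).map (extendZero K n (m - 1) m)) T ∧
    (solHGD n L (m - 1)).map (extendZero K n (m - 1) m) ⊔ T = solHGD n L m

/-- The centralizer `Z(L)` of `L` in `K[∂]`. -/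
def centralizer : Set (PseudoDiffOp K) := {A | A.IsDiffOp ∧ ⁅L, A⁆ = 0}

/-- `W_m(L)`: the differential operators `A` of order at most `m` that almost commute with `L`,
that is, `[L, A]` has order at most `n - 2`, where `n` is the order of `L`. -/
def almostCommuting (m : ℕ) : Set (PseudoDiffOp K) :=
  {A | A.IsDiffOp ∧ A.OrdLE m ∧ ⁅L, A⁆.OrdLE ((n : ℤ) - 2)}

/-- `M` is the level of the operator `L` of order `n`: the smallest `m` such that
`Z_m(L) = W_m(L) ∩ Z(L)` is not contained in `C[L]`. -/
def IsLevel (M : ℕ) : Prop :=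
  IsLeast {m : ℕ | ¬ almostCommuting n L m ∩ centralizer L ⊆
    (Algebra.adjoin (constants K) {L} : Set (PseudoDiffOp K))} M

end Specialization

end GelfandDickey

/-! The statements about $V_m$, $T_m$ and $F_m$ are linear algebra and need nothing about the
numbers $\sigma_{k,j}$. A vector of $V_m$ whose $m$-th entry is zero or absent comes from $V_{m-1}$
(`mem_map_extendZero`), so the $m$-th entry is injective on any complement $T_m$. Hence $T_m$ is
zero or a line, which rescaling puts in the form $\langle(\mathbf c,1)\rangle$
(`IsStep.eq_bot_or_eq_span`). Since $(c,1)\in V_m$ exactly when $c\in F_m$ (`appendOne_mem_solHGD`),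
$F_m$ is empty or a translate of $V_{m-1}$ (`solGD_eq`).

The level brings in the operators, through the equivalence $\mathcal Z_m(L)\subseteq C[L]\iff V_m=0$
(`almostCommuting_inter_centralizer_subset_iff`). By uniqueness of the $n$-th root, specialization
turns $\sigma_{k,j}$ into a coefficient of $[P_j(L),L]$ (`sigma_eq`). This commutator has order at
most $n-2$, so $\xi\in V_m$ means exactly that $\sum\xi_jP_j(L)$ commutes with $L$
(`mem_solHGD_iff`). Every operator in the centralizer is a constant combination of the $P_j(L)$
(`exists_eq_sum_specializedOp`). The terms with $n\mid j$ are powers of $L$, and a non-zero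
combination of the others has order prime to the pattern of $C[L]$, whose non-zero elements have
order divisible by $n$. At level $M$ this gives $V_{M-1}=0\ne V_M$, so $V_M$ is its own $T_M$. -/

namespace PseudoDiffOp

/-! ### Coefficients, positive parts and order bounds -/

section Coeff

variable {R : Type*} [CommRing R]

theorem sum_coeff {ι : Type*} (s : Finset ι) (f : ι → PseudoDiffOp R) (i : ℤ) :
    (∑ j ∈ s, f j).coeff i = ∑ j ∈ s, (f j).coeff i :=
  map_sum (AddMonoidHom.mk' (fun A : PseudoDiffOp R => A.coeff i) fun _ _ => rfl) f s

theorem posPart_coeff (A : PseudoDiffOp R) (i : ℤ) :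
    A.posPart.coeff i = if 0 ≤ i then A.coeff i else 0 := rfl

theorem isDiffOp_posPart (A : PseudoDiffOp R) : A.posPart.IsDiffOp := fun i hi => by
  rw [posPart_coeff, if_neg (not_le.mpr hi)]

theorem IsDiffOp.posPart_eq {A : PseudoDiffOp R} (hA : A.IsDiffOp) : A.posPart = A := by
  ext i
  rw [posPart_coeff]
  split_ifs with h
  · rfl
  · exact (hA i (not_le.mp h)).symm

theorem ordLE_sub_posPart (A : PseudoDiffOp R) : (A - A.posPart).OrdLE (-1) := fun i hi => by
  rw [sub_coeff, posPart_coeff, if_pos (by omega), sub_self]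

theorem IsMonicOfOrder.posPart {A : PseudoDiffOp R} {j : ℕ} (hA : A.IsMonicOfOrder j) :
    A.posPart.IsMonicOfOrder j := by
  refine ⟨fun i hi => ?_, ?_⟩
  · rw [posPart_coeff, hA.1 i hi, ite_self]
  · rw [posPart_coeff, if_pos (by omega), hA.2]

theorem OrdLE.mono {A : PseudoDiffOp R} {a b : ℤ} (hA : A.OrdLE a) (h : a ≤ b) : A.OrdLE b :=
  fun i hi => hA i (h.trans_lt hi)

theorem OrdLE.sub {A B : PseudoDiffOp R} {a : ℤ} (hA : A.OrdLE a) (hB : B.OrdLE a) :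
    (A - B).OrdLE a := fun i hi => by
  rw [sub_coeff, hA i hi, hB i hi, sub_self]

theorem OrdLE.of_coeff_eq_zero {A : PseudoDiffOp R} {a : ℤ} (hA : A.OrdLE a)
    (h : A.coeff a = 0) : A.OrdLE (a - 1) := fun i hi => by
  rcases eq_or_lt_of_le (show a ≤ i by omega) with rfl | h'
  exacts [h, hA i h']

end Coeff

/-! ### Products, commutators and change of coefficient ring -/

section Mul

variable {R : Type*} [CommRing R] [Differential R]

/-- For $i\ge 0$ the binomial $\binom ik$ vanishes once $k>i$, and a negative target exponent $l$
with $l-i+k\ge 0$ forces $k>i$. -/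
theorem IsDiffOp.mul {A B : PseudoDiffOp R} (hA : A.IsDiffOp) (hB : B.IsDiffOp) :
    (A * B).IsDiffOp := by
  intro l hl
  refine finsum_eq_zero_of_forall_eq_zero fun ⟨i, k⟩ => ?_
  rcases lt_or_ge i 0 with hi | hi
  · simp [mulTerm, hA i hi]
  rcases lt_or_ge (l - i + k) 0 with hk | hk
  · simp [mulTerm, hB _ hk]
  lift i to ℕ using hi
  have : i.choose k = 0 := Nat.choose_eq_zero_of_lt (by omega)
  simp [mulTerm, Ring.choose_natCast, this]

theorem IsDiffOp.pow {A : PseudoDiffOp R} (hA : A.IsDiffOp) (m : ℕ) : (A ^ m).IsDiffOp := by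
  induction m with
  | zero => exact fun i hi => by simp [hi.ne]
  | succ m ih => rw [pow_succ]; exact ih.mul hA

theorem IsDiffOp.lie {A B : PseudoDiffOp R} (hA : A.IsDiffOp) (hB : B.IsDiffOp) :
    ⁅A, B⁆.IsDiffOp := fun i hi => by
  rw [Ring.lie_def, sub_coeff, hA.mul hB i hi, hB.mul hA i hi, sub_self]

/-- The coefficient ring is commutative, so the top coefficients of $AB$ and $BA$ cancel. -/
theorem OrdLE.lie {A B : PseudoDiffOp R} {a b : ℤ} (hA : A.OrdLE a) (hB : B.OrdLE b) :
    ⁅A, B⁆.OrdLE (a + b - 1) := by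
  rw [Ring.lie_def]
  refine ((hA.mul hB).sub (add_comm b a ▸ hB.mul hA)).of_coeff_eq_zero ?_
  rw [sub_coeff, mul_coeff_top hA hB, add_comm a b, mul_coeff_top hB hA, mul_comm, sub_self]

/-- The subleading coefficient of a product. -/
theorem mul_coeff_top_sub_one {A B : PseudoDiffOp R} {a b : ℤ} (hA : A.OrdLE a)
    (hB : B.OrdLE b) : (A * B).coeff (a + b - 1) =
      A.coeff a * B.coeff (b - 1) + A.coeff (a - 1) * B.coeff b +
        a * (A.coeff a * (B.coeff b)′) := by
  -- A non-zero term needs $a-1+k\le i\le a$, which leaves these three pairs $(i,k)$.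
  rw [mul_coeff, finsum_eq_sum_of_support_subset (s := {(a, 0), (a - 1, 0), (a, 1)})]
  · rw [Finset.sum_insert (by simp; omega), Finset.sum_insert (by simp), Finset.sum_singleton]
    simp only [mulTerm, Ring.choose_zero_right, Ring.choose_one_right, one_smul,
      Function.iterate_zero, id_eq, Function.iterate_one, zsmul_eq_mul]
    rw [show a + b - 1 - a + ((0 : ℕ) : ℤ) = b - 1 by push_cast; ring,
      show a + b - 1 - (a - 1) + ((0 : ℕ) : ℤ) = b by push_cast; ring,
      show a + b - 1 - a + ((1 : ℕ) : ℤ) = b by push_cast; ring, add_assoc]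
  · rintro ⟨i, k⟩ hp
    have := mulTerm_ne hA hB hp
    simp only at this
    simp only [Finset.coe_insert, Finset.coe_singleton, Set.mem_insert_iff, Prod.mk.injEq,
      Set.mem_singleton_iff]
    omega

/-- The leading coefficient 1 of $A$ has zero derivative, so a single Leibniz term survives. In
characteristic zero, an operator commuting with a monic one of positive order therefore has constant
leading coefficient. -/
theorem lie_coeff_of_monic {A B : PseudoDiffOp R} {a b : ℤ} (hA : A.IsMonicOfOrder a)
    (hB : B.OrdLE b) : ⁅A, B⁆.coeff (a + b - 1) = a * (B.coeff b)′ := by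
  rw [Ring.lie_def, sub_coeff, mul_coeff_top_sub_one hA.1 hB, add_comm a b,
    mul_coeff_top_sub_one hB hA.1, hA.2]
  simp
  ring

/-- The homomorphism of rings of pseudo-differential operators induced by a homomorphism of
differential rings. -/
noncomputable def mapHom {S : Type*} [CommRing S] [Differential S] (φ : R →+* S)
    (hφ : ∀ x, φ x′ = (φ x)′) : PseudoDiffOp R →+* PseudoDiffOp S where
  toFun A := ⟨fun i => φ (A.coeff i), by
    obtain ⟨a, ha⟩ := A.bdd
    exact ⟨a, fun i hi => by rw [ha i hi, map_zero]⟩⟩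
  map_zero' := by ext i; exact map_zero φ
  map_add' A B := by ext i; exact map_add φ _ _
  map_one' := by
    ext i
    simp only [one_coeff]
    split_ifs <;> simp
  map_mul' A B := by
    ext l
    refine ((φ : R →+ S).map_finsum (mulTerm_finite A B l)).trans (finsum_congr fun p => ?_)
    have hD : ∀ (k : ℕ) (x : R), φ ((⇑(Differential.deriv : Derivation ℤ R R))^[k] x) =
        (⇑(Differential.deriv : Derivation ℤ S S))^[k] (φ x) := fun k x =>
      Function.Semiconj.iterate_right (f := φ) hφ k x
    simp only [mulTerm, AddMonoidHom.coe_coe, zsmul_eq_mul, map_mul, map_intCast, hD]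

@[simp]
theorem mapHom_coeff {S : Type*} [CommRing S] [Differential S] (φ : R →+* S)
    (hφ : ∀ x, φ x′ = (φ x)′) (A : PseudoDiffOp R) (i : ℤ) :
    (mapHom φ hφ A).coeff i = φ (A.coeff i) := rfl

theorem IsMonicOfOrder.mapHom {S : Type*} [CommRing S] [Differential S] (φ : R →+* S)
    (hφ : ∀ x, φ x′ = (φ x)′) {A : PseudoDiffOp R} {d : ℤ} (hA : A.IsMonicOfOrder d) :
    (mapHom φ hφ A).IsMonicOfOrder d :=
  ⟨fun i hi => by simp [hA.1 i hi], by simp [hA.2]⟩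

/-- `nthRoot` is only a chosen root; uniqueness identifies the image of one choice with the other.
-/
theorem mapHom_nthRoot {S : Type*} [CommRing S] [Differential S] [Algebra ℚ R] [Algebra ℚ S]
    (φ : R →+* S) (hφ : ∀ x, φ x′ = (φ x)′) {n : ℕ} (hn : 0 < n) {L : PseudoDiffOp R}
    (hL : L.IsMonicOfOrder n) : mapHom φ hφ (nthRoot n L) = nthRoot n (mapHom φ hφ L) := by
  have h := nthRoot_spec hn hL
  have hL' := hL.mapHom φ hφ
  exact (existsUnique_root hn hL').unique ⟨h.1.mapHom φ hφ, by rw [← map_pow, h.2]⟩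
    (nthRoot_spec hn hL')

theorem mapHom_posPart {S : Type*} [CommRing S] [Differential S] (φ : R →+* S)
    (hφ : ∀ x, φ x′ = (φ x)′) (A : PseudoDiffOp R) :
    mapHom φ hφ A.posPart = (mapHom φ hφ A).posPart := by
  ext i
  simp only [mapHom_coeff, posPart_coeff]
  split_ifs <;> simp

end Mul

end PseudoDiffOp

namespace GelfandDickey

open PseudoDiffOp

/-! ### Specialization at $L$ and the shape of the centralizer -/

section Specialization

variable {K : Type*} [Field K] [Differential K]

/-- By the Leibniz rule it suffices to check constants, where both sides vanish, and variables,
where both sides shift the derivative index by one. -/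
theorem specialize_deriv (n : ℕ) (L : PseudoDiffOp K) (x : DiffPoly n (constants K)) :
    specialize n L x′ = (specialize n L x)′ := by
  have hd : ∀ y : DiffPoly n (constants K), y′ = MvPolynomial.mkDerivation (constants K)
    (fun p : DiffVar n × ℕ => (MvPolynomial.X (p.1, p.2 + 1) : DiffPoly n (constants K))) y :=
    fun _ => rfl
  induction x using MvPolynomial.induction_on with
  | C a =>
    have ha : (a : K)′ = 0 := a.2
    rw [hd, MvPolynomial.derivation_C, map_zero, specialize, MvPolynomial.aeval_C]
    exact ha.symm
  | add p q hp hq => simp only [map_add, hp, hq]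
  | mul_X p i hp =>
    have hX : specialize n L (MvPolynomial.X i)′ = (specialize n L (MvPolynomial.X i))′ := by
      rw [hd, MvPolynomial.mkDerivation_X, specialize, MvPolynomial.aeval_X,
        MvPolynomial.aeval_X, Function.iterate_succ_apply']
    simp only [Derivation.leibniz, map_add, map_mul, smul_eq_mul, hp, hX]

theorem specialize_toRingHom_deriv (n : ℕ) (L : PseudoDiffOp K) (x : DiffPoly n (constants K)) :
    (specialize n L : DiffPoly n (constants K) →+* K) x′ =
      ((specialize n L : DiffPoly n (constants K) →+* K) x)′ :=
  specialize_deriv n L x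

theorem isMonicOfOrder_formalOp (n : ℕ) (C : Type*) [Field C] :
    (formalOp n C).IsMonicOfOrder n := by
  have h : ∀ i : ℤ, (n : ℤ) ≤ i → (∑ l : DiffVar n, monomial ((n : ℤ) - (l : ℕ))
      (MvPolynomial.X (l, 0) : DiffPoly n C)).coeff i = 0 := by
    intro i hi
    rw [sum_coeff]
    refine Finset.sum_eq_zero fun l _ => ?_
    have := (Finset.mem_Icc.mp l.2).1
    rw [monomial_coeff, if_neg (by omega)]
  refine ⟨fun i hi => ?_, ?_⟩
  · rw [formalOp, add_coeff, h i hi.le, monomial_coeff, if_neg hi.ne', add_zero]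
  · rw [formalOp, add_coeff, h n le_rfl, monomial_coeff, if_pos rfl, add_zero]

theorem mapHom_formalOp {n : ℕ} {L : PseudoDiffOp K} (hL : L.IsNormalForm n) :
    mapHom (specialize n L : DiffPoly n (constants K) →+* K) (specialize_toRingHom_deriv n L)
      (formalOp n (constants K)) = L := by
  ext i
  have hX : ∀ l : DiffVar n, specialize n L (MvPolynomial.X (l, 0)) =
      L.coeff ((n : ℤ) - (l : ℕ)) := fun l => by
    rw [specialize, MvPolynomial.aeval_X]; rfl
  rw [mapHom_coeff, formalOp, add_coeff, sum_coeff, map_add, map_sum]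
  simp only [monomial_coeff, RingHom.coe_coe, apply_ite (specialize n L), map_one, map_zero, hX]
  rcases lt_or_ge (n : ℤ) i with h | h
  · rw [hL.2.1.1 i h, if_neg h.ne', zero_add]
    refine Finset.sum_eq_zero fun l _ => if_neg ?_
    omega
  rcases h.eq_or_lt with rfl | h
  · rw [hL.2.1.2, if_pos rfl, Finset.sum_eq_zero, add_zero]
    intro l _
    have := (Finset.mem_Icc.mp l.2).1
    exact if_neg (by omega)
  rw [if_neg h.ne, zero_add]
  by_cases hi : 0 ≤ i ∧ i ≤ n - 2
  -- The only variable attached to $\partial^i$ is $u_{n-i}$.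
  · rw [Finset.sum_eq_single ⟨(n - i).toNat, Finset.mem_Icc.mpr (by omega)⟩]
    · have : (n : ℤ) - ((n - i).toNat : ℕ) = i := by omega
      simp only [this, if_true]
    · intro l _ hl
      refine if_neg fun h' => hl (Subtype.ext ?_)
      simp only
      omega
    · simp
  -- What remains is $i<0$ or $i=n-1$, exactly the coefficients that the normal form makes zero.
  · have : L.coeff i = 0 := by
      by_cases h0 : i < 0
      · exact hL.1 i h0
      · rw [show i = n - 1 by omega, hL.2.2]
    rw [this]
    refine Finset.sum_eq_zero fun l _ => if_neg ?_
    have := Finset.mem_Icc.mp l.2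
    omega

/-- The specialized almost commuting operator `P_j(L) = ((L^{1/n})^j)₊`. -/
noncomputable def specializedOp (n : ℕ) (L : PseudoDiffOp K) (j : ℕ) : PseudoDiffOp K :=
  (nthRoot n L ^ j).posPart

variable [CharZero K]

/-- Makes the differential polynomials over the constants a ℚ-algebra, as existence and uniqueness
of the formal root require. -/
instance : CharZero (constants K) := 
  ((constants K).subtype.charZero_iff (constants K).subtype_injective).mpr inferInstance

/-- Specialization is a homomorphism of differential rings, so it commutes with products, roots and
positive parts. This allows all later arguments to take place over $K$. -/
theorem sigma_eq {n : ℕ} (hn : 0 < n) {L : PseudoDiffOp K} (hL : L.IsNormalForm n) (k j : ℕ) :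
    sigma n L k j = ⁅specializedOp n L j, L⁆.coeff k := by
  have h1 := mapHom_formalOp hL
  have h2 := mapHom_nthRoot (specialize n L : DiffPoly n (constants K) →+* K)
    (specialize_toRingHom_deriv n L) hn (isMonicOfOrder_formalOp n (constants K))
  rw [h1] at h2
  have h3 : mapHom (specialize n L : DiffPoly n (constants K) →+* K) (specialize_toRingHom_deriv n L)
      ⁅almostCommutingOp n (constants K) j, formalOp n (constants K)⁆ =
      ⁅specializedOp n L j, L⁆ := by
    rw [Ring.lie_def, map_sub, map_mul, map_mul, h1, almostCommutingOp, mapHom_posPart, map_pow,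
      h2, Ring.lie_def, specializedOp]
  rw [← h3]
  rfl

theorem isMonicOfOrder_specializedOp {n : ℕ} (hn : 0 < n) {L : PseudoDiffOp K}
    (hL : L.IsMonicOfOrder n) (j : ℕ) : (specializedOp n L j).IsMonicOfOrder j :=
  ((nthRoot_spec hn hL).1.pow j).posPart

theorem nthRoot_pow_mul {n : ℕ} (hn : 0 < n) {L : PseudoDiffOp K} (hL : L.IsMonicOfOrder n)
    (i : ℕ) : nthRoot n L ^ (n * i) = L ^ i := by
  rw [pow_mul, (nthRoot_spec hn hL).2]

theorem lie_nthRoot_pow {n : ℕ} (hn : 0 < n) {L : PseudoDiffOp K} (hL : L.IsMonicOfOrder n)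
    (j : ℕ) : ⁅L, nthRoot n L ^ j⁆ = 0 := by
  have h := (nthRoot_spec hn hL).2
  nth_rw 1 [← h]
  rw [Ring.lie_def, ← pow_add, ← pow_add, add_comm, sub_self]

theorem specializedOp_mul {n : ℕ} (hn : 0 < n) {L : PseudoDiffOp K} (hL : L.IsNormalForm n)
    (i : ℕ) : specializedOp n L (n * i) = L ^ i := by
  rw [specializedOp, nthRoot_pow_mul hn hL.2.1, (hL.1.pow i).posPart_eq]

/-- With $Q=L^{1/n}$, $[L,Q^j]=0$ gives $[L,P_j]=-[L,Q^j-P_j]$. The tail $Q^j-P_j$ has order at most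
$-1$, so the commutator has order at most $n+(-1)-1$. -/
theorem ordLE_lie_specializedOp {n : ℕ} (hn : 0 < n) {L : PseudoDiffOp K}
    (hL : L.IsNormalForm n) (j : ℕ) : ⁅L, specializedOp n L j⁆.OrdLE ((n : ℤ) - 2) := by
  have h := hL.2.1.1.lie (ordLE_sub_posPart (nthRoot n L ^ j))
  rw [Ring.lie_def, mul_sub, sub_mul, sub_sub_sub_comm, ← Ring.lie_def, ← Ring.lie_def,
    lie_nthRoot_pow hn hL.2.1] at h
  intro i hi
  have := h i (by omega)
  rw [sub_coeff, zero_coeff, zero_sub, neg_eq_zero] at this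
  exact this

/-- Operators commuting with `L` are, up to negative order, constant linear combinations of powers
of the root of `L`. -/
theorem exists_ordLE_sub_sum {n : ℕ} (hn : 0 < n) {L : PseudoDiffOp K}
    (hL : L.IsMonicOfOrder n) (m : ℕ) (A : PseudoDiffOp K) (hA : A.OrdLE ((m : ℤ) - 1))
    (hLA : ⁅L, A⁆ = 0) : ∃ c : ℕ → constants K,
      (A - ∑ j ∈ Finset.range m, c j • nthRoot n L ^ j).OrdLE (-1) := by
  induction m generalizing A with
  | zero => exact ⟨0, by simpa using hA⟩
  | succ m ih =>
    have hA' : A.OrdLE m := by simpa using hA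
    -- The coefficient of $\partial^{n+m-1}$ in $[L,A]=0$ is $n\,a_m'$, so $a_m$ is constant.
    -- Subtracting $a_m$ times the $m$-th power of the root lowers the order and preserves
    -- commutation.
    have h := lie_coeff_of_monic hL hA'
    rw [hLA, zero_coeff] at h
    have ha : (A.coeff m)′ = 0 := by
      rcases mul_eq_zero.mp h.symm with h | h
      · simp [hn.ne'] at h
      · exact h
    let a : constants K := ⟨A.coeff m, ha⟩
    have hQ := (nthRoot_spec hn hL).1.pow m
    have hsm : (a • nthRoot n L ^ m).OrdLE m := fun i hi => by
      rw [smul_coeff, hQ.1 i hi, smul_zero]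
    obtain ⟨c, hc⟩ := ih (A - a • nthRoot n L ^ m)
      ((hA'.sub hsm).of_coeff_eq_zero (by
        rw [sub_coeff, smul_coeff, hQ.2, Subfield.smul_def, smul_eq_mul, mul_one, sub_self]))
      (by
        rw [Ring.lie_def, mul_sub, sub_mul, mul_smul_comm, smul_mul_assoc, sub_sub_sub_comm,
          ← smul_sub, ← Ring.lie_def, ← Ring.lie_def, hLA, lie_nthRoot_pow hn hL, smul_zero,
          sub_zero])
    refine ⟨Function.update c m a, ?_⟩
    rw [Finset.sum_range_succ, Function.update_self, Finset.sum_congr rfl fun j hj => by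
      rw [Function.update_of_ne (Finset.mem_range.mp hj).ne]]
    rwa [add_comm, ← sub_sub]

/-- Taking positive parts in `exists_ordLE_sub_sum` removes the remainder of negative order and
leaves $A$ unchanged. -/
theorem exists_eq_sum_specializedOp {n : ℕ} (hn : 0 < n) {L : PseudoDiffOp K}
    (hL : L.IsMonicOfOrder n) {m : ℕ} {A : PseudoDiffOp K} (hA : A.OrdLE m) (hA0 : A.IsDiffOp)
    (hLA : ⁅L, A⁆ = 0) : ∃ c : ℕ → constants K,
      A = ∑ j ∈ Finset.range (m + 1), c j • specializedOp n L j := by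
  obtain ⟨c, hc⟩ := exists_ordLE_sub_sum hn hL (m + 1) A (by simpa using hA) hLA
  refine ⟨c, ?_⟩
  ext i
  simp only [sum_coeff, smul_coeff, specializedOp, posPart_coeff]
  split_ifs with hi
  · have := hc i (by omega)
    simpa only [sub_coeff, sum_coeff, smul_coeff, sub_eq_zero] using this
  · simp [hA0 i (not_le.mp hi)]

/-- The order of a non-zero element of `C[L]` is a multiple of the order of `L`. -/
theorem dvd_order_of_mem_adjoin {n : ℕ} (hn : 0 < n) {L : PseudoDiffOp K}
    (hL : L.IsMonicOfOrder n) {A : PseudoDiffOp K} {d : ℕ}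
    (hA : A ∈ Algebra.adjoin (constants K) {L}) (hd : A.OrdLE d) (hd0 : A.coeff d ≠ 0) :
    n ∣ d := by
  rw [Algebra.adjoin_singleton_eq_range_aeval] at hA
  obtain ⟨p, rfl⟩ := hA
  have hpow : ∀ i : ℕ, (L ^ i).IsMonicOfOrder (n * i : ℕ) := fun i => by
    rw [← nthRoot_pow_mul hn hL]
    exact (nthRoot_spec hn hL).1.pow _
  have hp0 : p ≠ 0 := by
    rintro rfl
    simp at hd0
  have hp : (Polynomial.aeval L).toRingHom p =
      ∑ i ∈ Finset.range (p.natDegree + 1), p.coeff i • L ^ i := Polynomial.aeval_eq_sum_range _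
  rw [hp] at hd hd0
  simp only [OrdLE, sum_coeff, smul_coeff] at hd hd0
  have hlt : ∀ {i : ℕ}, i ∈ Finset.range (p.natDegree + 1) → ∀ {l : ℤ},
      (n * p.natDegree : ℕ) ≤ l → (i ≠ p.natDegree ∨ (n * p.natDegree : ℕ) < l) →
      p.coeff i • (L ^ i).coeff l = 0 := by
    intro i hi l h1 h2
    rw [(hpow i).1, smul_zero]
    have hi' : i ≤ p.natDegree := Nat.lt_succ_iff.mp (Finset.mem_range.mp hi)
    rcases h2 with h2 | h2
    · refine lt_of_lt_of_le ?_ h1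
      exact_mod_cast Nat.mul_lt_mul_of_pos_left (lt_of_le_of_ne hi' h2) hn
    · refine lt_of_le_of_lt ?_ h2
      exact_mod_cast Nat.mul_le_mul_left n hi'
  -- If $d>n\deg p$, the coefficient at $d$ would vanish; if $d<n\deg p$, the order bound would kill
  -- the leading coefficient of $p$.
  refine ⟨p.natDegree, le_antisymm (not_lt.mp fun h => hd0 ?_) (not_lt.mp fun h => hp0 ?_)⟩
  · exact Finset.sum_eq_zero fun i hi => hlt hi (by exact_mod_cast h.le)
      (Or.inr (by exact_mod_cast h))
  · have h1 := hd (n * p.natDegree : ℕ) (by exact_mod_cast h)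
    rw [Finset.sum_eq_single p.natDegree (fun i hi hne => hlt hi le_rfl (Or.inl hne)) (by simp),
      (hpow _).2, Subfield.smul_def, smul_eq_mul, mul_one] at h1
    exact Polynomial.leadingCoeff_eq_zero.mp (Subtype.ext h1)

end Specialization

end GelfandDickey

namespace GelfandDickey

open PseudoDiffOp

/-! ### Linear algebra of the solution spaces -/

section LinearAlgebra

variable {K : Type*} [Field K] [Differential K] {n : ℕ}

theorem mem_indexSet {m j : ℕ} : j ∈ indexSet n m ↔ j ≤ m ∧ ¬ n ∣ j := by
  simp [indexSet]

theorem indexSet_mono {k m : ℕ} (h : k ≤ m) : indexSet n k ⊆ indexSet n m := fun _ hj =>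
  mem_indexSet.mpr ⟨(mem_indexSet.mp hj).1.trans h, (mem_indexSet.mp hj).2⟩

theorem indexSet_eq_insert {m : ℕ} (hm : ¬ n ∣ m) :
    indexSet n m = insert m (indexSet n (m - 1)) := by
  ext j
  rw [Finset.mem_insert, mem_indexSet, mem_indexSet]
  have h0 : m ≠ 0 := fun h => hm (h ▸ dvd_zero n)
  constructor
  · rintro ⟨h1, h2⟩
    by_cases h : j = m
    · exact Or.inl h
    · exact Or.inr ⟨by omega, h2⟩
  · rintro (rfl | ⟨h1, h2⟩)
    · exact ⟨le_rfl, hm⟩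
    · exact ⟨by omega, h2⟩

theorem notMem_indexSet_sub_one {m : ℕ} (hm : ¬ n ∣ m) : m ∉ indexSet n (m - 1) := fun h => by
  have h0 : m ≠ 0 := fun h => hm (h ▸ dvd_zero n)
  have := (mem_indexSet.mp h).1
  omega

theorem extendZero_apply_of_mem {k m j : ℕ} (ξ : indexSet n k → constants K)
    (hm : j ∈ indexSet n m) (hk : j ∈ indexSet n k) : extendZero K n k m ξ ⟨j, hm⟩ = ξ ⟨j, hk⟩ :=
  dif_pos hk

theorem extendZero_apply_of_notMem {k m j : ℕ} (ξ : indexSet n k → constants K)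
    (hm : j ∈ indexSet n m) (hk : j ∉ indexSet n k) : extendZero K n k m ξ ⟨j, hm⟩ = 0 :=
  dif_neg hk

theorem appendOne_apply_of_mem {m j : ℕ} (c : indexSet n (m - 1) → constants K)
    (hm : j ∈ indexSet n m) (hk : j ∈ indexSet n (m - 1)) : appendOne c ⟨j, hm⟩ = c ⟨j, hk⟩ :=
  dif_pos hk

theorem appendOne_apply_self {m : ℕ} (c : indexSet n (m - 1) → constants K)
    (hm : m ∈ indexSet n m) : appendOne c ⟨m, hm⟩ = 1 :=
  dif_neg (notMem_indexSet_sub_one (mem_indexSet.mp hm).2)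

theorem extendZero_injective {k m : ℕ} (h : k ≤ m) :
    Function.Injective (extendZero K n k m) := fun a b hab => by
  ext ⟨j, hj⟩
  have := congrFun hab ⟨j, indexSet_mono h hj⟩
  rw [extendZero_apply_of_mem _ _ hj, extendZero_apply_of_mem _ _ hj] at this
  rw [this]

theorem sum_extendZero {k m : ℕ} (h : k ≤ m) (ξ : indexSet n k → constants K) (f : ℕ → K) :
    ∑ j : indexSet n m, (extendZero K n k m ξ j : K) * f j =
      ∑ j : indexSet n k, (ξ j : K) * f j := by
  symm
  refine Finset.sum_of_injOn (fun j => ⟨j, indexSet_mono h j.2⟩)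
    (fun a _ b _ hab => Subtype.ext (Subtype.mk.inj hab)) (fun _ _ => Finset.mem_univ _)
    ?_ ?_
  · rintro ⟨j, hj⟩ - hj'
    rw [extendZero_apply_of_notMem _ _ fun hk => hj' ⟨⟨j, hk⟩, Finset.mem_univ _, rfl⟩]
    simp
  · rintro ⟨j, hj⟩ -
    rw [extendZero_apply_of_mem _ _ hj]

theorem extendZero_mem_solHGD {k m : ℕ} (h : k ≤ m) (L : PseudoDiffOp K)
    (ξ : indexSet n k → constants K) :
    extendZero K n k m ξ ∈ solHGD n L m ↔ ξ ∈ solHGD n L k :=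
  forall₂_congr fun _ _ => by rw [sum_extendZero h]

theorem appendOne_sub_appendOne {m : ℕ} (hm : ¬ n ∣ m) (c d : indexSet n (m - 1) → constants K) :
    (appendOne c : indexSet n m → constants K) - appendOne d =
      extendZero K n (m - 1) m (c - d) := by
  ext ⟨j, hj⟩
  rw [Pi.sub_apply]
  by_cases hk : j ∈ indexSet n (m - 1)
  · rw [appendOne_apply_of_mem _ _ hk, appendOne_apply_of_mem _ _ hk,
      extendZero_apply_of_mem _ _ hk, Pi.sub_apply]
  · rw [extendZero_apply_of_notMem _ _ hk]
    have : j = m := by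
      rw [indexSet_eq_insert hm, Finset.mem_insert] at hj
      exact hj.resolve_right hk
    subst this
    rw [appendOne_apply_self, appendOne_apply_self, sub_self]

/-- Split $(c,1)=(0,1)+(c,0)$: the first summand contributes the inhomogeneous term $\sigma_{k,m}$,
the second the sum over $J_{n,m-1}$. -/
theorem appendOne_mem_solHGD {m : ℕ} (hm : ¬ n ∣ m) (L : PseudoDiffOp K)
    (c : indexSet n (m - 1) → constants K) :
    appendOne c ∈ solHGD n L m ↔ c ∈ solGD n L m := by
  refine forall₂_congr fun k _ => ?_
  have hmm : m ∈ indexSet n m := mem_indexSet.mpr ⟨le_rfl, hm⟩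
  have h1 : ∑ j : indexSet n m, ((appendOne (0 : indexSet n (m - 1) → constants K) :
      indexSet n m → constants K) j : K) * sigma n L k j = sigma n L k m := by
    rw [Finset.sum_eq_single ⟨m, hmm⟩]
    · rw [appendOne_apply_self]; simp
    · rintro ⟨j, hj⟩ - hne
      rw [indexSet_eq_insert hm, Finset.mem_insert] at hj
      rw [appendOne_apply_of_mem _ _ (hj.resolve_left fun h => hne (Subtype.ext h))]
      simp
    · simp
  have h2 := appendOne_sub_appendOne hm c 0
  rw [sub_zero, sub_eq_iff_eq_add'] at h2
  rw [h2, ← sum_extendZero (Nat.sub_le m 1) c (sigma n L k), ← h1, ← Finset.sum_add_distrib]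
  simp only [Pi.add_apply, Subfield.coe_add, add_mul]

/-- The hypothesis is conditional on $m\in J_{n,m}$, so the case $n\mid m$ is included: there it is
vacuous and $J_{n,m}=J_{n,m-1}$. -/
theorem eq_extendZero {m : ℕ} {v : indexSet n m → constants K}
    (hv : ∀ hm : m ∈ indexSet n m, v ⟨m, hm⟩ = 0) :
    v = extendZero K n (m - 1) m fun j => v ⟨j, indexSet_mono (Nat.sub_le m 1) j.2⟩ := by
  ext ⟨j, hj⟩
  by_cases hk : j ∈ indexSet n (m - 1)
  · rw [extendZero_apply_of_mem _ _ hk]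
  · rw [extendZero_apply_of_notMem _ _ hk]
    have : j = m := by
      by_contra h
      have := mem_indexSet.mp hj
      exact hk (mem_indexSet.mpr ⟨by omega, this.2⟩)
    subst this
    rw [hv]

theorem mem_map_extendZero {m : ℕ} (L : PseudoDiffOp K) {v : indexSet n m → constants K}
    (hv : v ∈ solHGD n L m) (h0 : ∀ hm : m ∈ indexSet n m, v ⟨m, hm⟩ = 0) :
    v ∈ (solHGD n L (m - 1)).map (extendZero K n (m - 1) m) := by
  have h := eq_extendZero h0
  refine ⟨_, ?_, h.symm⟩
  exact (extendZero_mem_solHGD (Nat.sub_le m 1) L _).mp (h ▸ hv)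

theorem map_extendZero_le {k m : ℕ} (h : k ≤ m) (L : PseudoDiffOp K) :
    (solHGD n L k).map (extendZero K n k m) ≤ solHGD n L m := by
  rintro _ ⟨ξ, hξ, rfl⟩
  exact (extendZero_mem_solHGD h L ξ).mpr hξ

/-- A complement in the ambient space, cut down to $V_m$; the modular law shows that it still spans
with $V_{m-1}$. -/
theorem exists_isStep (L : PseudoDiffOp K) (m : ℕ) : ∃ T, IsStep n L m T := by
  obtain ⟨T, hT⟩ := exists_isCompl ((solHGD n L (m - 1)).map (extendZero K n (m - 1) m))
  refine ⟨T ⊓ solHGD n L m, hT.disjoint.mono_right inf_le_left, ?_⟩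
  rw [← sup_inf_assoc_of_le T (map_extendZero_le (Nat.sub_le m 1) L), hT.sup_eq_top, top_inf_eq]

theorem IsStep.le {L : PseudoDiffOp K} {m : ℕ}
    {T : Submodule (constants K) (indexSet n m → constants K)} (hT : IsStep n L m T) :
    T ≤ solHGD n L m :=
  hT.2 ▸ le_sup_right

/-- Such a vector lies both in $T$ and in the image of $V_{m-1}$. -/
theorem IsStep.eq_zero {L : PseudoDiffOp K} {m : ℕ}
    {T : Submodule (constants K) (indexSet n m → constants K)} (hT : IsStep n L m T)
    {t : indexSet n m → constants K} (ht : t ∈ T)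
    (h0 : ∀ hm : m ∈ indexSet n m, t ⟨m, hm⟩ = 0) : t = 0 :=
  Submodule.disjoint_def.mp hT.1 t (mem_map_extendZero L (hT.le ht) h0) ht

theorem IsStep.eq_bot_or_eq_span {L : PseudoDiffOp K} {m : ℕ}
    {T : Submodule (constants K) (indexSet n m → constants K)} (hT : IsStep n L m T) :
    T = ⊥ ∨ ¬ n ∣ m ∧ ∃ c, T = Submodule.span (constants K) {appendOne c} := by
  refine or_iff_not_imp_left.mpr fun hbot => ?_
  obtain ⟨t, ht, ht0⟩ := Submodule.exists_mem_ne_zero_of_ne_bot hbot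
  have hne : ∃ hm : m ∈ indexSet n m, t ⟨m, hm⟩ ≠ 0 := by
    by_contra! h
    exact ht0 (hT.eq_zero ht h)
  obtain ⟨hmm, htm⟩ := hne
  have hm := (mem_indexSet.mp hmm).2
  -- Rescale $t$ so that its $m$-th entry becomes 1.
  let c : indexSet n (m - 1) → constants K :=
    fun j => (t ⟨m, hmm⟩)⁻¹ * t ⟨j, indexSet_mono (Nat.sub_le m 1) j.2⟩
  refine ⟨hm, c, ?_⟩
  have hc : appendOne c = (t ⟨m, hmm⟩)⁻¹ • t := by
    ext ⟨j, hj⟩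
    rw [Pi.smul_apply, smul_eq_mul]
    by_cases hk : j ∈ indexSet n (m - 1)
    · exact congrArg Subtype.val (appendOne_apply_of_mem _ _ hk)
    · have : j = m := by
        rw [indexSet_eq_insert hm, Finset.mem_insert] at hj
        exact hj.resolve_right hk
      subst this
      rw [appendOne_apply_self, inv_mul_cancel₀ htm]
  have hcT : appendOne c ∈ T := hc ▸ T.smul_mem _ ht
  refine le_antisymm (fun s hs => ?_) ((Submodule.span_singleton_le_iff_mem _ _).mpr hcT)
  -- $s-s_m(c,1)$ lies in $T$ and has $m$-th entry zero, hence vanishes.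
  refine Submodule.mem_span_singleton.mpr ⟨s ⟨m, hmm⟩, Eq.symm (sub_eq_zero.mp ?_)⟩
  refine hT.eq_zero (T.sub_mem hs (T.smul_mem _ hcT)) fun _ => ?_
  rw [Pi.sub_apply, Pi.smul_apply, appendOne_apply_self, smul_eq_mul, mul_one, sub_self]

theorem appendOne_ne_zero {m : ℕ} (hm : ¬ n ∣ m) (c : indexSet n (m - 1) → constants K) :
    (appendOne c : indexSet n m → constants K) ≠ 0 := fun h => by
  have := congrFun h ⟨m, mem_indexSet.mpr ⟨le_rfl, hm⟩⟩
  rw [appendOne_apply_self] at this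
  exact one_ne_zero this

/-- Given $(c,1)\in V_m$, the vector $(d,1)$ lies in $V_m$ exactly when the difference $(d-c,0)$
does, that is, when $d-c\in V_{m-1}$. -/
theorem solGD_eq {L : PseudoDiffOp K} {m : ℕ} (hm : ¬ n ∣ m)
    {c : indexSet n (m - 1) → constants K} (hc : appendOne c ∈ solHGD n L m) :
    solGD n L m = (AffineSubspace.mk' c (solHGD n L (m - 1)) : Set _) := by
  ext d
  rw [SetLike.mem_coe, AffineSubspace.mem_mk', vsub_eq_sub, ← appendOne_mem_solHGD hm,
    ← extendZero_mem_solHGD (Nat.sub_le m 1), ← appendOne_sub_appendOne hm]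
  exact ((solHGD n L m).sub_mem_iff_left hc).symm

/-- Here $V_m$ is the image of $V_{m-1}$, all of whose vectors have $m$-th entry 0, so no $(c,1)$
occurs. -/
theorem IsStep.solGD_eq_empty {L : PseudoDiffOp K} {m : ℕ} (hm : ¬ n ∣ m)
    (hT : IsStep n L m ⊥) : solGD n L m = ∅ := by
  refine Set.eq_empty_iff_forall_notMem.mpr fun c hc => ?_
  rw [← appendOne_mem_solHGD hm, ← hT.2, sup_bot_eq] at hc
  obtain ⟨ξ, -, h⟩ := hc
  have hmm : m ∈ indexSet n m := mem_indexSet.mpr ⟨le_rfl, hm⟩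
  have := congrFun h ⟨m, hmm⟩
  rw [appendOne_apply_self, extendZero_apply_of_notMem _ _ (notMem_indexSet_sub_one hm)] at this
  exact zero_ne_one this

end LinearAlgebra

/-! ### Commuting operators and the level -/

section Level

variable {K : Type*} [Field K] [CharZero K] [Differential K] {n : ℕ}

/-- The commutator is a differential operator of order at most $n-2$, so the $n-1$ equations of the
system already control all its coefficients. -/
theorem mem_solHGD_iff (hn : 0 < n) {L : PseudoDiffOp K} (hL : L.IsNormalForm n) {m : ℕ}
    (ξ : indexSet n m → constants K) :
    ξ ∈ solHGD n L m ↔ ⁅L, ∑ j : indexSet n m, ξ j • specializedOp n L j⁆ = 0 := by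
  have hcoeff : ∀ i : ℤ, ⁅L, ∑ j : indexSet n m, ξ j • specializedOp n L j⁆.coeff i =
      ∑ j : indexSet n m, (ξ j : K) * ⁅L, specializedOp n L j⁆.coeff i := by
    intro i
    rw [Ring.lie_def, Finset.mul_sum, Finset.sum_mul, ← Finset.sum_sub_distrib, sum_coeff]
    refine Finset.sum_congr rfl fun j _ => ?_
    rw [mul_smul_comm, smul_mul_assoc, ← smul_sub, ← Ring.lie_def, smul_coeff,
      Subfield.smul_def, smul_eq_mul]
  have hsig : ∀ k : ℕ, ∑ j : indexSet n m, (ξ j : K) * sigma n L k j =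
      -⁅L, ∑ j : indexSet n m, ξ j • specializedOp n L j⁆.coeff k := by
    intro k
    rw [hcoeff, ← Finset.sum_neg_distrib]
    refine Finset.sum_congr rfl fun j _ => ?_
    rw [sigma_eq hn hL, Ring.lie_def, Ring.lie_def, ← neg_sub, neg_coeff, mul_neg]
  constructor
  · intro h
    ext i
    rw [zero_coeff]
    rcases lt_or_ge i 0 with hi | hi
    · rw [hcoeff]
      refine Finset.sum_eq_zero fun j _ => ?_
      rw [specializedOp, hL.1.lie (isDiffOp_posPart _) i hi, mul_zero]
    rcases lt_or_ge ((n : ℤ) - 2) i with hi' | hi'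
    · rw [hcoeff]
      refine Finset.sum_eq_zero fun j _ => ?_
      rw [ordLE_lie_specializedOp hn hL j i hi', mul_zero]
    lift i to ℕ using hi
    rw [← neg_eq_zero, ← hsig]
    exact h i (by omega)
  · intro h k _
    rw [hsig, h, zero_coeff, neg_zero]

/-- `Z_m(L) ⊆ C[L]` if and only if `V_m = 0`. -/
theorem almostCommuting_inter_centralizer_subset_iff (hn : 0 < n) {L : PseudoDiffOp K}
    (hL : L.IsNormalForm n) (m : ℕ) :
    almostCommuting n L m ∩ centralizer L ⊆
      (Algebra.adjoin (constants K) {L} : Set (PseudoDiffOp K)) ↔ solHGD n L m = ⊥ := by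
  classical
  constructor
  · intro h
    by_contra hbot
    obtain ⟨ξ, hξ, hξ0⟩ := Submodule.exists_mem_ne_zero_of_ne_bot hbot
    obtain ⟨i, hi⟩ := Function.ne_iff.mp hξ0
    -- Since $P_j(L)$ is monic of order $j$, the largest index $d$ in the support of $\xi$ is the
    -- order of the sum. As $n\nmid d$, the sum cannot lie in $C[L]$.
    obtain ⟨d, hd, hmax⟩ := (Finset.univ.filter fun j => ξ j ≠ 0).exists_max_image
      (fun j => (j : ℕ)) ⟨i, by simpa using hi⟩
    rw [Finset.mem_filter] at hd
    have hP := isMonicOfOrder_specializedOp hn hL.2.1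
    set A := ∑ j : indexSet n m, ξ j • specializedOp n L j with hA
    have hlt : ∀ (j : indexSet n m) (l : ℤ), (d : ℕ) ≤ l → (j ≠ d ∨ (d : ℕ) < l) →
        (ξ j • specializedOp n L j).coeff l = 0 := by
      intro j l h1 h2
      rw [smul_coeff]
      by_cases hj : ξ j = 0
      · rw [hj, zero_smul]
      have hjd : (j : ℕ) ≤ d := hmax j (by simpa using hj)
      rw [(hP j).1, smul_zero]
      rcases h2 with h2 | h2
      · have : (j : ℕ) ≠ d := fun h => h2 (Subtype.ext h)
        omega
      · omega
    have hAd : A.OrdLE (d : ℕ) := fun l hl => by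
      rw [hA, sum_coeff]
      exact Finset.sum_eq_zero fun j _ => hlt j l hl.le (Or.inr hl)
    have hAd0 : A.coeff (d : ℕ) ≠ 0 := by
      rw [hA, sum_coeff, Finset.sum_eq_single d (fun j _ hj => hlt j _ le_rfl (Or.inl hj))
        (by simp), smul_coeff, (hP d).2, Subfield.smul_def, smul_eq_mul, mul_one]
      exact fun h0 => hd.2 (Subtype.ext h0)
    have hdm := mem_indexSet.mp d.2
    have hA0 : A.IsDiffOp := fun l hl => by
      rw [hA, sum_coeff]
      exact Finset.sum_eq_zero fun j _ => by
        rw [smul_coeff, specializedOp, isDiffOp_posPart _ l hl, smul_zero]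
    have hLA : ⁅L, A⁆ = 0 := (mem_solHGD_iff hn hL ξ).mp hξ
    refine hdm.2 (dvd_order_of_mem_adjoin hn hL.2.1 (h ⟨⟨hA0, hAd.mono ?_, ?_⟩, hA0, hLA⟩)
      hAd hAd0)
    · exact_mod_cast hdm.1
    · rw [hLA]
      exact fun _ _ => rfl
  · rintro h A ⟨⟨-, hAm, -⟩, hA0, hLA⟩
    obtain ⟨c, rfl⟩ := exists_eq_sum_specializedOp hn hL.2.1 hAm hA0 hLA
    have hL' : L ∈ Algebra.adjoin (constants K) {L} := Algebra.self_mem_adjoin_singleton _ _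
    have hdvd : ∑ j ∈ Finset.range (m + 1) with n ∣ j, c j • specializedOp n L j ∈
        Algebra.adjoin (constants K) {L} := by
      refine Subalgebra.sum_mem _ fun j hj => Subalgebra.smul_mem _ ?_ _
      obtain ⟨i, rfl⟩ := (Finset.mem_filter.mp hj).2
      rw [specializedOp_mul hn hL]
      exact Subalgebra.pow_mem _ hL' i
    -- The part with $n\mid j$ is a polynomial in $L$ and commutes with $L$. Hence the other part
    -- commutes too, so its coefficients form an element of $V_m=0$.
    have hsplit := Finset.sum_filter_add_sum_filter_not (Finset.range (m + 1)) (fun j => n ∣ j)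
      fun j => c j • specializedOp n L j
    have hlie : ⁅L, ∑ j ∈ Finset.range (m + 1) with n ∣ j, c j • specializedOp n L j⁆ = 0 := by
      rw [Ring.lie_def, Finset.mul_sum, Finset.sum_mul, ← Finset.sum_sub_distrib]
      refine Finset.sum_eq_zero fun j hj => ?_
      obtain ⟨i, rfl⟩ := (Finset.mem_filter.mp hj).2
      rw [specializedOp_mul hn hL, mul_smul_comm, smul_mul_assoc, ← pow_succ,
        ← pow_succ', sub_self]
    have hsum : ∑ j : indexSet n m, c j • specializedOp n L j =
        ∑ j ∈ Finset.range (m + 1) with ¬ n ∣ j, c j • specializedOp n L j :=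
      Finset.sum_coe_sort (indexSet n m) fun j => c j • specializedOp n L j
    have hmem : (fun j : indexSet n m => c j) ∈ solHGD n L m := by
      rw [mem_solHGD_iff hn hL, hsum]
      rwa [← hsplit, Ring.lie_def, mul_add, add_mul, add_sub_add_comm, ← Ring.lie_def,
        ← Ring.lie_def, hlie, zero_add] at hLA
    rw [h, Submodule.mem_bot] at hmem
    have hzero : ∑ j : indexSet n m, c j • specializedOp n L j = 0 :=
      Finset.sum_eq_zero fun j _ => by rw [show c j = 0 from congrFun hmem j, zero_smul]
    rw [← hsplit, ← hsum, hzero, add_zero]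
    exact hdvd

theorem IsLevel.solHGD_ne_bot (hn : 0 < n) {L : PseudoDiffOp K} (hL : L.IsNormalForm n) {M : ℕ}
    (hM : IsLevel n L M) : solHGD n L M ≠ ⊥ := fun h =>
  hM.1 ((almostCommuting_inter_centralizer_subset_iff hn hL M).mpr h)

theorem IsLevel.solHGD_eq_bot (hn : 0 < n) {L : PseudoDiffOp K} (hL : L.IsNormalForm n) {M m : ℕ}
    (hM : IsLevel n L M) (hm : m < M) : solHGD n L m = ⊥ := by
  rw [← almostCommuting_inter_centralizer_subset_iff hn hL]
  by_contra h
  exact hm.not_ge (hM.2 h)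

/-- $J_{n,0}$ is empty, so $V_0=0$. Positivity ensures that $M-1$ is truly below the level. -/
theorem IsLevel.pos (hn : 0 < n) {L : PseudoDiffOp K} (hL : L.IsNormalForm n) {M : ℕ}
    (hM : IsLevel n L M) : 0 < M := by
  refine Nat.pos_of_ne_zero ?_
  rintro rfl
  refine hM.solHGD_ne_bot hn hL ((Submodule.eq_bot_iff _).mpr fun ξ _ => ?_)
  ext ⟨j, hj⟩
  have := mem_indexSet.mp hj
  exact absurd (Nat.le_zero.mp this.1 ▸ dvd_zero n) this.2

end Level

end GelfandDickey

theorem mainTheorem5 {K : Type*} [Field K] [CharZero K] [Differential K]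
    (n : ℕ) (hn : 0 < n) (L : PseudoDiffOp K) (hL : L.IsNormalForm n) :
    (∀ m : ℕ,
      Function.Injective (GelfandDickey.extendZero K n m (m + 1)) ∧
      (GelfandDickey.solHGD n L m).map (GelfandDickey.extendZero K n m (m + 1)) ≤
        GelfandDickey.solHGD n L (m + 1)) ∧
    (∀ m : ℕ, 1 ≤ m →
      (∃ T, GelfandDickey.IsStep n L m T) ∧
      ∀ T, GelfandDickey.IsStep n L m T →
        Module.finrank (GelfandDickey.constants K) T ≤ 1 ∧
        (Module.finrank (GelfandDickey.constants K) T = 1 →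
          ¬ n ∣ m ∧ ∃ c, T = Submodule.span (GelfandDickey.constants K)
            {GelfandDickey.appendOne c})) ∧
    (∀ m : ℕ, ¬ n ∣ m → ∀ T, GelfandDickey.IsStep n L m T →
      (GelfandDickey.solGD n L m = ∅ ∧ T = ⊥) ∨
      ∃ c, T = Submodule.span (GelfandDickey.constants K) {GelfandDickey.appendOne c} ∧
        GelfandDickey.solGD n L m =
          (AffineSubspace.mk' c (GelfandDickey.solHGD n L (m - 1)) : Set _)) ∧
    (∀ M : ℕ, GelfandDickey.IsLevel n L M →
      ¬ n ∣ M ∧ ∃ c, GelfandDickey.solGD n L M = {c} ∧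
        GelfandDickey.solHGD n L M = Submodule.span (GelfandDickey.constants K)
          {GelfandDickey.appendOne c}) := by
  refine ⟨fun m => ⟨GelfandDickey.extendZero_injective m.le_succ,
    GelfandDickey.map_extendZero_le m.le_succ L⟩, fun m _ =>
    ⟨GelfandDickey.exists_isStep L m, fun T hT => ?_⟩, fun m hm T hT => ?_, fun M hM => ?_⟩
  · rcases hT.eq_bot_or_eq_span with rfl | ⟨hm, c, rfl⟩
    · simp
    · exact ⟨(finrank_span_singleton (GelfandDickey.appendOne_ne_zero hm c)).le,
        fun _ => ⟨hm, c, rfl⟩⟩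
  · rcases hT.eq_bot_or_eq_span with rfl | ⟨-, c, rfl⟩
    · exact Or.inl ⟨hT.solGD_eq_empty hm, rfl⟩
    · exact Or.inr ⟨c, rfl, GelfandDickey.solGD_eq hm
        (hT.le (Submodule.mem_span_singleton_self _))⟩
  · have hbot := hM.solHGD_eq_bot hn hL (Nat.sub_lt (hM.pos hn hL) one_pos)
    -- As $V_{M-1}=0$, all of $V_M$ serves as the complement, and the affine space $F_M$ shrinks to
    -- a point.
    have hT : GelfandDickey.IsStep n L M (GelfandDickey.solHGD n L M) := by
      constructor <;> simp [hbot]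
    rcases hT.eq_bot_or_eq_span with h | ⟨hm, c, h⟩
    · exact absurd h (hM.solHGD_ne_bot hn hL)
    · refine ⟨hm, c, ?_, h⟩
      rw [GelfandDickey.solGD_eq hm (h ▸ Submodule.mem_span_singleton_self _), hbot]
      ext d
      simp [AffineSubspace.mem_mk', sub_eq_zero]
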